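/- For $f\in C[0,1]$ (the continuous functions $f:[0,1]\to\mathbb{R}$) let $G_f=\{(x,f(x)):x\in[0,1]\}\subset\mathbb{R}^2$ be its graph, where $\mathbb{R}^2$ carries the Euclidean metric. Let $\dim_H$ and $\dim_P$ denote Hausdorff and packing dimension. For a nonempty bounded set $F$ let $N_\delta(F)$ be the smallest number of sets of diameter at most $\delta$ that cover $F$; the box dimension $\dim_B F$ exists and equals $d$ if $$\liminf_{\delta\to0^+}\frac{\log N_\delta(F)}{-\log\delta}=\limsup_{\delta\to0^+}\frac{\log N_\delta(F)}{-\log\delta}=d.$$ Theorem. Let $1\le\beta\le2$. Then each of the three sets $$\{f\in C[0,1]:\dim_H G_f=\beta\},$$ $$\{f\in C[0,1]:\dim_B G_f\text{ exists and equals }\beta\},$$ $$\{f\in C[0,1]:\dim_P G_f=\beta\}$$ is dense in $C[0,1]$ with respect to the supremum norm. -/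

import Mathlib

open Set Filter Topology
open scoped ENNReal NNReal

noncomputable section

namespace FractalDim

section MetricSpaces

variable {X : Type*} [MetricSpace X]

/-- `coverNumber F δ` is the smallest number of sets of diameter at most `δ` which can cover `F`
(it is `⊤` when no finite number suffices). -/
def coverNumber (F : Set X) (δ : ℝ) : ℕ∞ :=
  ⨅ (n : ℕ) (_ : ∃ U : Fin n → Set X,
    (∀ i, Metric.ediam (U i) ≤ ENNReal.ofReal δ) ∧ F ⊆ ⋃ i, U i), (n : ℕ∞)

/-- The quotient `log N_δ(F) / (- log δ)`. -/
def boxQuotient (F : Set X) (δ : ℝ) : EReal :=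
  ENNReal.log (coverNumber F δ : ℝ≥0∞) / ((-Real.log δ : ℝ) : EReal)

/-- The lower box dimension of `F`: the lower limit, as `δ → 0+`, of `log N_δ(F) / (- log δ)`. -/
def lowerBoxDim (F : Set X) : EReal :=
  liminf (boxQuotient F) (𝓝[>] (0 : ℝ))

/-- The upper box dimension of `F`: the upper limit, as `δ → 0+`, of `log N_δ(F) / (- log δ)`. -/
def upperBoxDim (F : Set X) : EReal :=
  limsup (boxQuotient F) (𝓝[>] (0 : ℝ))

/-- The box dimension of `F` exists and equals `d`: the lower and the upper box dimension
coincide, with common value `d`. -/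
def HasBoxDim (F : Set X) (d : ℝ) : Prop :=
  lowerBoxDim F = (d : EReal) ∧ upperBoxDim F = (d : EReal)

/-- A `δ`-packing of `F`: a countable collection of pairwise disjoint closed balls with centres
in `F` and positive radii at most `δ`. A ball is given as the pair of its centre and radius. -/
def IsBallPacking (F : Set X) (δ : ℝ) (T : Set (X × ℝ)) : Prop :=
  T.Countable ∧ (∀ p ∈ T, p.1 ∈ F ∧ 0 < p.2 ∧ p.2 ≤ δ) ∧
    T.PairwiseDisjoint (fun p => Metric.closedBall p.1 p.2)

/-- `P^s_δ(F)`: the supremum of `∑ |B_i|^s` over all `δ`-packings `{B_i}` of `F`. -/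
def packingPremeasureAt (s : ℝ≥0) (δ : ℝ) (F : Set X) : ℝ≥0∞ :=
  ⨆ (T : Set (X × ℝ)) (_ : IsBallPacking F δ T),
    ∑' p : T, Metric.ediam (Metric.closedBall p.1.1 p.1.2) ^ (s : ℝ)

/-- `P^s_0(F)`: the limit of `P^s_δ(F)` as `δ → 0+`. Since `P^s_δ(F)` is nondecreasing in `δ`,
this limit is the infimum over `δ > 0`. -/
def packingPremeasure (s : ℝ≥0) (F : Set X) : ℝ≥0∞ :=
  ⨅ (δ : ℝ) (_ : 0 < δ), packingPremeasureAt s δ F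

/-- The `s`-dimensional packing measure `P^s(F)`: the infimum of `∑ P^s_0(F_i)` over all countable
covers `F ⊆ ⋃ F_i`. -/
def packingMeasure (s : ℝ≥0) (F : Set X) : ℝ≥0∞ :=
  ⨅ (G : ℕ → Set X) (_ : F ⊆ ⋃ i, G i), ∑' i, packingPremeasure s (G i)

/-- The packing dimension of `F`: the infimum of all `s ≥ 0` with `P^s(F) = 0`. -/
def packingDim (F : Set X) : ℝ≥0∞ :=
  ⨅ (s : ℝ≥0) (_ : packingMeasure s F = 0), (s : ℝ≥0∞)

end MetricSpaces

/-- The graph `{(x, f x) : x ∈ [0,1]}` of a continuous function on `[0,1]`, as a subset of the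
Euclidean plane. -/
def graph (f : C(unitInterval, ℝ)) : Set (EuclideanSpace ℝ (Fin 2)) :=
  Set.range fun x : unitInterval => !₂[(x : ℝ), f x]

end FractalDim

end

namespace FractalDim

open MeasureTheory

/-! ### Comparison of box, Hausdorff and packing dimension -/

section MetricSpaces

variable {X : Type*} [MetricSpace X]

/-! Since `dimH` is at most both the packing dimension and the lower box dimension, and the packing
dimension is at most the upper box dimension, all three claims follow from the density of the
functions whose graph has Hausdorff dimension at least `β` and upper box dimension at most `β`
(`dense_le_dimH_and_upperBoxDim_le`). Such functions are obtained as `p + c • z`, with `p` a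
polynomial close to the given function, `c` small, and `z` one fixed function whose graph has
dimension `β`. A Lipschitz summand does not affect the two bounds: it is removed by a Lipschitz
shear of the plane, and it adds only `O(3⁻ⁿ)` to the oscillation at scale `3⁻ⁿ`.

The function `z` is a zigzag. A piece of height `h n` over a triadic interval of length `3⁻ⁿ` is
replaced by three pieces, either all in the same direction, of height `h n / 3` (sign `1`), or
forth, back and forth, of height `h n` (sign `-1`). The choices are made so that `h n` is about `3 ^
(-(2 - β) n)`. Then about `3ⁿ · 3ⁿ h n ≈ 3 ^ (β n)` squares of side `3⁻ⁿ` cover the graph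
(`upperBoxDim_graph_le`). For the lower bound, both replacements preserve the distribution of
values, so each piece takes its values uniformly on an interval of length `h n`
(`integral_comp_zigzag`). Hence Lebesgue measure lifted to the graph gives a square of side `3⁻ⁿ`
mass at most about `3⁻ⁿ · 3⁻ⁿ / h n ≈ 3 ^ (-β n)`, and the mass distribution principle applies
(`le_dimH_graph`). -/

theorem coverNumber_lt_iff {F : Set X} {δ : ℝ} {a : ℕ∞} :
    coverNumber F δ < a ↔ ∃ n : ℕ, (∃ U : Fin n → Set X,
      (∀ i, Metric.ediam (U i) ≤ ENNReal.ofReal δ) ∧ F ⊆ ⋃ i, U i) ∧ (n : ℕ∞) < a := by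
  simp only [coverNumber, iInf_lt_iff, exists_prop]

theorem coverNumber_le {F : Set X} {δ : ℝ} {n : ℕ} (U : Fin n → Set X)
    (hU : ∀ i, Metric.ediam (U i) ≤ ENNReal.ofReal δ) (hF : F ⊆ ⋃ i, U i) :
    coverNumber F δ ≤ n :=
  iInf₂_le n ⟨U, hU, hF⟩

theorem boxQuotient_lt_iff {F : Set X} {δ s : ℝ} (h0 : 0 < δ) (h1 : δ < 1) :
    boxQuotient F δ < (s : EReal) ↔ (coverNumber F δ : ℝ≥0∞) < ENNReal.ofReal (δ ^ (-s)) := by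
  have hlog : 0 < -Real.log δ := neg_pos.2 (Real.log_neg h0 h1)
  rw [boxQuotient, EReal.div_lt_iff (by exact_mod_cast hlog) (EReal.coe_ne_top _),
    ← ENNReal.log_lt_log_iff, ENNReal.log_ofReal, if_neg (Real.rpow_pos_of_pos h0 _).not_ge,
    Real.log_rpow h0, ← EReal.coe_mul, mul_neg, neg_mul]

theorem upperBoxDim_le_of_coverNumber_le {F : Set X} {C s : ℝ}
    (h : ∀ᶠ δ in 𝓝[>] (0 : ℝ), (coverNumber F δ : ℝ≥0∞) ≤ ENNReal.ofReal (C * δ ^ (-s))) :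
    upperBoxDim F ≤ s := by
  rw [← EReal.le_of_forall_lt_iff_le]
  intro t ht
  have hst : s < t := by exact_mod_cast ht
  have hlim : Tendsto (fun δ : ℝ => C * δ ^ (t - s)) (𝓝[>] 0) (𝓝 (C * 0)) := by
    refine Tendsto.const_mul _ ?_
    have := (Real.continuousAt_rpow_const 0 (t - s) (Or.inr (sub_pos.2 hst).le)).tendsto
    rw [Real.zero_rpow (sub_pos.2 hst).ne'] at this
    exact this.mono_left nhdsWithin_le_nhds
  rw [mul_zero] at hlim
  refine limsup_le_of_le (h := ?_)
  filter_upwards [h, hlim.eventually_lt_const one_pos, Ioo_mem_nhdsGT one_pos] with δ hδ hC hδ1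
  refine ((boxQuotient_lt_iff hδ1.1 hδ1.2).2 (hδ.trans_lt ?_)).le
  have hp := Real.rpow_pos_of_pos hδ1.1 (-t)
  refine (ENNReal.ofReal_lt_ofReal_iff hp).2 ?_
  calc C * δ ^ (-s) = C * δ ^ (t - s) * δ ^ (-t) := by
        rw [mul_assoc, ← Real.rpow_add hδ1.1]; ring_nf
    _ < 1 * δ ^ (-t) := by gcongr
    _ = δ ^ (-t) := one_mul _

theorem eventually_coverNumber_lt {F : Set X} {s : ℝ} (h : upperBoxDim F < s) :
    ∀ᶠ δ in 𝓝[>] (0 : ℝ), (coverNumber F δ : ℝ≥0∞) < ENNReal.ofReal (δ ^ (-s)) := by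
  filter_upwards [eventually_lt_of_limsup_lt h, Ioo_mem_nhdsGT one_pos] with δ hδ hδ1
  exact (boxQuotient_lt_iff hδ1.1 hδ1.2).1 hδ

/-- Along scales `δ k → 0` there are covers by at most `δ k ^ (-s)` sets of diameter at most `δ k`;
their Hausdorff sums are at most `1`, so the `s`-dimensional Hausdorff measure is at most `1`. -/
theorem dimH_le_of_lowerBoxDim_lt {F : Set X} {s : ℝ≥0} (h : lowerBoxDim F < (s : ℝ)) :
    dimH F ≤ s := by
  borelize X
  have hfreq : ∃ᶠ δ in 𝓝[>] (0 : ℝ),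
      (coverNumber F δ : ℝ≥0∞) < ENNReal.ofReal (δ ^ (-(s : ℝ))) ∧ δ ∈ Ioo (0 : ℝ) 1 := by
    refine ((frequently_lt_of_liminf_lt (h := h)).and_eventually
      (Ioo_mem_nhdsGT one_pos)).mono ?_
    rintro δ ⟨hδ, hδ1⟩
    exact ⟨(boxQuotient_lt_iff hδ1.1 hδ1.2).1 hδ, hδ1⟩
  have hex : ∀ k : ℕ, ∃ δ : ℝ, ((coverNumber F δ : ℝ≥0∞) < ENNReal.ofReal (δ ^ (-(s : ℝ))) ∧
      δ ∈ Ioo (0 : ℝ) 1) ∧ δ ∈ Ioo (0 : ℝ) (1 / (k + 1)) := fun k =>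
    (hfreq.and_eventually (Ioo_mem_nhdsGT Nat.one_div_pos_of_nat)).exists
  choose δ hδ hδk using hex
  have hcov : ∀ k, ∃ n : ℕ, (∃ U : Fin n → Set X,
      (∀ i, Metric.ediam (U i) ≤ ENNReal.ofReal (δ k)) ∧ F ⊆ ⋃ i, U i) ∧
        (n : ℝ≥0∞) ≤ ENNReal.ofReal (δ k ^ (-(s : ℝ))) := by
    intro k
    have htop : coverNumber F (δ k) < ⊤ := by
      rw [lt_top_iff_ne_top]
      intro h'
      have := (hδ k).1
      rw [h'] at this
      simp at this
    have : coverNumber F (δ k) < coverNumber F (δ k) + 1 :=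
      ENat.lt_add_one_iff htop.ne |>.2 le_rfl
    obtain ⟨n, hU, hn⟩ := coverNumber_lt_iff.1 this
    refine ⟨n, hU, le_trans ?_ (hδ k).1.le⟩
    have hn' := (ENat.lt_add_one_iff htop.ne).1 hn
    exact_mod_cast ENat.toENNReal_le.2 hn'
  choose n hn hnle using hcov
  choose U hU hFU using hn
  refine dimH_le_of_hausdorffMeasure_ne_top (ne_top_of_le_ne_top ENNReal.one_ne_top ?_)
  have hlim : Tendsto (fun k => ENNReal.ofReal (δ k)) atTop (𝓝 0) := by
    rw [← ENNReal.ofReal_zero]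
    refine ENNReal.tendsto_ofReal (squeeze_zero (fun k => (hδk k).1.le) (fun k => (hδk k).2.le)
      tendsto_one_div_add_atTop_nhds_zero_nat)
  refine (Measure.hausdorffMeasure_le_liminf_sum (s : ℝ) F (fun k => ENNReal.ofReal (δ k)) hlim U
    (Eventually.of_forall hU) (Eventually.of_forall hFU)).trans ?_
  refine liminf_le_of_le (h := fun b hb => ?_)
  obtain ⟨k, hk⟩ := hb.exists
  refine hk.trans ?_
  calc ∑ i, Metric.ediam (U k i) ^ (s : ℝ)
      ≤ ∑ _i : Fin (n k), ENNReal.ofReal (δ k) ^ (s : ℝ) := by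
        gcongr with i; exact hU k i
    _ = n k * ENNReal.ofReal (δ k) ^ (s : ℝ) := by simp
    _ ≤ ENNReal.ofReal (δ k ^ (-(s : ℝ))) * ENNReal.ofReal (δ k) ^ (s : ℝ) := by
        gcongr; exact hnle k
    _ = 1 := by
        rw [ENNReal.ofReal_rpow_of_pos (hδk k).1,
          ← ENNReal.ofReal_mul (Real.rpow_nonneg (hδk k).1.le _), ← Real.rpow_add (hδk k).1]
        simp

/-- The number of disjoint closed balls of radius larger than `δ` with centres in `F` is at most
the covering number of `F` at scale `δ`. -/
theorem encard_le_coverNumber {F : Set X} {δ : ℝ} (hδ : 0 ≤ δ) {T : Set (X × ℝ)}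
    (hF : ∀ p ∈ T, p.1 ∈ F) (hr : ∀ p ∈ T, δ < p.2)
    (hd : T.PairwiseDisjoint fun p => Metric.closedBall p.1 p.2) :
    T.encard ≤ coverNumber F δ := by
  refine le_iInf₂ fun n ⟨U, hU, hFU⟩ => ?_
  have hmem : ∀ p : T, ∃ i, p.1.1 ∈ U i := fun p => mem_iUnion.1 (hFU (hF p p.2))
  choose g hg using hmem
  have hinj : Function.Injective g := by
    intro p q hpq
    by_contra hne
    have hdist : edist p.1.1 q.1.1 ≤ ENNReal.ofReal δ :=
      Metric.edist_le_of_ediam_le (hg p) (hpq ▸ hg q) (hU _)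
    rw [edist_le_ofReal hδ] at hdist
    have hdis := hd p.2 q.2 fun h => hne (Subtype.ext h)
    refine Set.disjoint_left.1 hdis (?_ : q.1.1 ∈ _)
      (Metric.mem_closedBall_self (hδ.trans (hr q q.2).le))
    rw [Metric.mem_closedBall, dist_comm]
    exact hdist.trans (hr p p.2).le
  have := ENat.card_le_card_of_injective hinj
  rwa [ENat.card_eq_coe_fintype_card (α := Fin n), Fintype.card_fin] at this

theorem ediam_closedBall_le {x : X} {r : ℝ} (hr : 0 ≤ r) :
    Metric.ediam (Metric.closedBall x r) ≤ ENNReal.ofReal (2 * r) := by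
  rw [← Metric.closedEBall_ofReal hr, ENNReal.ofReal_mul zero_le_two]
  simpa using Metric.ediam_closedEBall_le (x := x) (r := ENNReal.ofReal r)

/-- The balls of a packing are grouped by dyadic size of the radius. Disjointness bounds the number
in each class by a covering number, so the packing sum is dominated by a geometric series of ratio
`q = 2 ^ (t - s) < 1`, whose tail from `k₀` on tends to zero. -/
theorem packingPremeasure_eq_zero {F : Set X} {t : ℝ} {s : ℝ≥0} (hts : t < s)
    (h : ∀ᶠ δ in 𝓝[>] (0 : ℝ), (coverNumber F δ : ℝ≥0∞) ≤ ENNReal.ofReal (δ ^ (-t))) :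
    packingPremeasure s F = 0 := by
  set q : ℝ := (2⁻¹ : ℝ) ^ ((s : ℝ) - t) with hq
  have hq0 : 0 < q := by positivity
  have hq1 : q < 1 := Real.rpow_lt_one (by norm_num) (by norm_num) (sub_pos.2 hts)
  obtain ⟨ε, hε, hεF⟩ := mem_nhdsGT_iff_exists_Ioo_subset.1 h
  have hpow : Tendsto (fun k : ℕ => (2⁻¹ : ℝ) ^ k) atTop (𝓝 0) :=
    tendsto_pow_atTop_nhds_zero_of_lt_one (by norm_num) (by norm_num)
  obtain ⟨k₁, hk₁⟩ := (hpow.eventually_lt_const (mem_Ioi.1 hε)).exists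
  -- The factor `2 ^ t` comes from counting at the lower end of the dyadic range of radii, and `2 ^
  -- s` from the diameter being at most twice the radius.
  set D : ℝ := 2 ^ t * 2 ^ (s : ℝ) with hD
  have key : ∀ k₀, k₁ ≤ k₀ →
      packingPremeasure s F ≤ ENNReal.ofReal (D * (1 - q)⁻¹ * q ^ k₀) := by
    intro k₀ hk₀
    refine (iInf₂_le ((2⁻¹ : ℝ) ^ k₀) (by positivity)).trans (iSup₂_le fun T hT => ?_)
    obtain ⟨-, hT, hd⟩ := hT
    set A : ℕ → Set (X × ℝ) := fun k =>
      {p ∈ T | (2⁻¹ : ℝ) ^ (k₀ + k + 1) < p.2 ∧ p.2 ≤ (2⁻¹ : ℝ) ^ (k₀ + k)} with hA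
    have hTA : T = ⋃ k, A k := by
      ext p
      simp only [hA, mem_iUnion, mem_ofPred_eq]
      refine ⟨fun hp => ?_, fun ⟨k, hk⟩ => hk.1⟩
      obtain ⟨-, h0, hle⟩ := hT p hp
      have hx : p.2 / (2⁻¹ : ℝ) ^ k₀ ≤ 1 := by
        rw [div_le_one (by positivity)]; exact hle
      obtain ⟨k, hk1, hk2⟩ := exists_nat_pow_near_of_lt_one (x := p.2 / (2⁻¹ : ℝ) ^ k₀)
        (y := 2⁻¹) (by positivity) hx (by norm_num) (by norm_num)
      rw [lt_div_iff₀ (by positivity)] at hk1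
      rw [div_le_iff₀ (by positivity)] at hk2
      refine ⟨k, hp, ?_, ?_⟩
      · rwa [add_assoc, add_comm, pow_add]
      · rwa [add_comm, pow_add]
    have hterm : ∀ k, ∑' p : A k, Metric.ediam (Metric.closedBall p.1.1 p.1.2) ^ (s : ℝ) ≤
        ENNReal.ofReal (D * q ^ k₀ * q ^ k) := by
      intro k
      have hcard : ((A k).encard : ℝ≥0∞) ≤
          ENNReal.ofReal (((2⁻¹ : ℝ) ^ (k₀ + k + 1)) ^ (-t)) := by
        refine le_trans (ENat.toENNReal_le.2 (encard_le_coverNumber (F := F) (by positivity)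
          (fun p hp => (hT p hp.1).1) (fun p hp => hp.2.1)
          (hd.subset fun p hp => hp.1))) (hεF ⟨by positivity, ?_⟩)
        refine lt_of_le_of_lt ?_ hk₁
        exact pow_le_pow_of_le_one (by norm_num) (by norm_num) (by omega)
      calc ∑' p : A k, Metric.ediam (Metric.closedBall p.1.1 p.1.2) ^ (s : ℝ)
          ≤ ∑' _p : A k, ENNReal.ofReal ((2 * (2⁻¹ : ℝ) ^ (k₀ + k)) ^ (s : ℝ)) := by
            refine ENNReal.tsum_le_tsum fun p => ?_
            rw [← ENNReal.ofReal_rpow_of_nonneg (by positivity) s.coe_nonneg]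
            refine ENNReal.rpow_le_rpow ((ediam_closedBall_le (hT p p.2.1).2.1.le).trans ?_) s.coe_nonneg
            exact ENNReal.ofReal_le_ofReal (by linarith [p.2.2.2])
        _ = (A k).encard * ENNReal.ofReal ((2 * (2⁻¹ : ℝ) ^ (k₀ + k)) ^ (s : ℝ)) := by
            rw [ENNReal.tsum_const]; rfl
        _ ≤ ENNReal.ofReal (((2⁻¹ : ℝ) ^ (k₀ + k + 1)) ^ (-t)) *
            ENNReal.ofReal ((2 * (2⁻¹ : ℝ) ^ (k₀ + k)) ^ (s : ℝ)) := by gcongr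
        _ = ENNReal.ofReal (D * q ^ k₀ * q ^ k) := by
            rw [← ENNReal.ofReal_mul (by positivity)]
            congr 1
            rw [mul_assoc, ← pow_add, hq, hD, ← Real.rpow_natCast, ← Real.rpow_natCast,
              ← Real.rpow_natCast, ← Real.rpow_mul (by norm_num),
              Real.mul_rpow (by norm_num) (by positivity), ← Real.rpow_mul (by norm_num),
              ← Real.rpow_mul (by norm_num)]
            simp only [Real.inv_rpow zero_le_two, ← Real.rpow_neg zero_le_two,
              ← Real.rpow_add zero_lt_two]
            push_cast
            ring_nf
    calc ∑' p : T, Metric.ediam (Metric.closedBall p.1.1 p.1.2) ^ (s : ℝ)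
        = ∑' p : (⋃ k, A k : Set (X × ℝ)),
            Metric.ediam (Metric.closedBall p.1.1 p.1.2) ^ (s : ℝ) := by rw [← hTA]
      _ ≤ ∑' k, ∑' p : A k, Metric.ediam (Metric.closedBall p.1.1 p.1.2) ^ (s : ℝ) :=
          ENNReal.tsum_iUnion_le_tsum
            (fun p : X × ℝ => Metric.ediam (Metric.closedBall p.1 p.2) ^ (s : ℝ)) A
      _ ≤ ∑' k, ENNReal.ofReal (D * q ^ k₀ * q ^ k) := ENNReal.tsum_le_tsum hterm
      _ = ENNReal.ofReal (∑' k, D * q ^ k₀ * q ^ k) :=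
          (ENNReal.ofReal_tsum_of_nonneg (fun k => by positivity)
            ((summable_geometric_of_lt_one hq0.le hq1).mul_left _)).symm
      _ = ENNReal.ofReal (D * (1 - q)⁻¹ * q ^ k₀) := by
          rw [tsum_mul_left, tsum_geometric_of_lt_one hq0.le hq1]; ring_nf
  have hlim : Tendsto (fun k₀ : ℕ => ENNReal.ofReal (D * (1 - q)⁻¹ * q ^ k₀)) atTop (𝓝 0) := by
    rw [← ENNReal.ofReal_zero]
    refine ENNReal.tendsto_ofReal ?_
    simpa using (tendsto_pow_atTop_nhds_zero_of_lt_one hq0.le hq1).const_mul (D * (1 - q)⁻¹)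
  exact le_antisymm (ge_of_tendsto hlim (eventually_atTop.2 ⟨k₁, key⟩)) bot_le

theorem packingDim_le_of_upperBoxDim_lt {F : Set X} {s : ℝ≥0} (h : upperBoxDim F < (s : ℝ)) :
    packingDim F ≤ s := by
  obtain ⟨t, ht, hts⟩ := EReal.lt_iff_exists_real_btwn.1 h
  suffices h0 : packingMeasure s F ≤ 0 from
    iInf₂_le (f := fun (s : ℝ≥0) (_ : packingMeasure s F = 0) => (s : ℝ≥0∞)) s
      (nonpos_iff_eq_zero.1 h0)
  refine (iInf₂_le (fun _ => F) (subset_iUnion (fun _ : ℕ => F) 0)).trans ?_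
  simp [packingPremeasure_eq_zero (by exact_mod_cast hts)
    ((eventually_coverNumber_lt ht).mono fun _ h => h.le)]

end MetricSpaces

section NormedSpaces

variable {E : Type*} [NormedAddCommGroup E] [NormedSpace ℝ E] [Nontrivial E]

/-- Packing sums are formed with diameters, which in a general metric space may be far smaller than
the radius; this bound excludes that. -/
theorem ofReal_le_ediam_closedBall (x : E) {r : ℝ} (hr : 0 ≤ r) :
    ENNReal.ofReal r ≤ Metric.ediam (Metric.closedBall x r) := by
  obtain ⟨v, hv⟩ := exists_norm_eq E hr
  have h1 : x + v ∈ Metric.closedBall x r := by simp [hv]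
  have := Metric.edist_le_ediam_of_mem h1 (Metric.mem_closedBall_self hr)
  rwa [edist_dist, dist_eq_norm, add_sub_cancel_left, hv] at this

variable [SecondCountableTopology E]

/-- By Vitali's lemma a disjoint family of balls of radius `δ / (k + 1)` covers `F` after
enlargement by `5`. The enlarged balls have diameter at most ten radii, hence at most ten times that
of the original ball, which gives `10 ^ s`. -/
theorem hausdorffMeasure_le_packingPremeasureAt [MeasurableSpace E] [BorelSpace E] (s : ℝ≥0)
    {δ : ℝ} (hδ : 0 < δ) (F : Set E) :
    μH[s] F ≤ 10 ^ (s : ℝ) * packingPremeasureAt s δ F := by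
  have hex : ∀ k : ℕ, ∃ u ⊆ F,
      (u.PairwiseDisjoint fun a => Metric.closedBall a (δ / (k + 1))) ∧
        ∀ a ∈ F, ∃ b ∈ u, Metric.closedBall a (δ / (k + 1)) ⊆
          Metric.closedBall b (5 * (δ / (k + 1))) := fun k =>
    Vitali.exists_disjoint_subfamily_covering_enlargement_closedBall F id
      (fun _ => δ / (k + 1)) _ (fun _ _ => le_rfl) 5 (by norm_num)
  choose u huF hdisj hcov using hex
  have hpos : ∀ k : ℕ, 0 < δ / (k + 1) := fun k => by positivity
  have hcount : ∀ k, (u k).Countable := fun k => by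
    refine (hdisj k).countable_of_nonempty_interior fun a _ => ?_
    exact ⟨a, Metric.ball_subset_interior_closedBall (Metric.mem_ball_self (hpos k))⟩
  have : ∀ k, Countable (u k) := fun k => (hcount k).to_subtype
  have hlim : Tendsto (fun k : ℕ => ENNReal.ofReal (10 * (δ / (k + 1)))) atTop (𝓝 0) := by
    rw [← ENNReal.ofReal_zero]
    refine ENNReal.tendsto_ofReal ?_
    have := (tendsto_one_div_add_atTop_nhds_zero_nat (𝕜 := ℝ)).const_mul (10 * δ)
    rw [mul_zero] at this
    refine this.congr fun k => by ring
  have hdiam : ∀ (k : ℕ) (a : E), Metric.ediam (Metric.closedBall a (5 * (δ / (k + 1)))) ≤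
      ENNReal.ofReal (10 * (δ / (k + 1))) := fun k a => by
    refine (ediam_closedBall_le (by have := hpos k; positivity)).trans_eq ?_
    congr 1; ring
  refine (Measure.hausdorffMeasure_le_liminf_tsum (s : ℝ) F _ hlim
    (fun k (a : u k) => Metric.closedBall a.1 (5 * (δ / (k + 1))))
    (Eventually.of_forall fun k a => hdiam k a) (Eventually.of_forall fun k a ha => ?_)).trans ?_
  · obtain ⟨b, hb, hab⟩ := hcov k a ha
    exact mem_iUnion.2 ⟨⟨b, hb⟩, hab (Metric.mem_closedBall_self (hpos k).le)⟩
  refine liminf_le_of_le (h := fun b hb => ?_)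
  obtain ⟨k, hk⟩ := hb.exists
  refine hk.trans ?_
  calc ∑' a : u k, Metric.ediam (Metric.closedBall a.1 (5 * (δ / (k + 1)))) ^ (s : ℝ)
      ≤ ∑' a : u k, 10 ^ (s : ℝ) *
          Metric.ediam (Metric.closedBall a.1 (δ / (k + 1))) ^ (s : ℝ) := by
        refine ENNReal.tsum_le_tsum fun a => ?_
        rw [← ENNReal.mul_rpow_of_nonneg _ _ s.coe_nonneg]
        refine ENNReal.rpow_le_rpow ((hdiam k a).trans ?_) s.coe_nonneg
        rw [ENNReal.ofReal_mul (by norm_num)]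
        simp only [ENNReal.ofReal_ofNat]
        gcongr
        exact ofReal_le_ediam_closedBall _ (hpos k).le
    _ = 10 ^ (s : ℝ) * ∑' a : u k,
          Metric.ediam (Metric.closedBall a.1 (δ / (k + 1))) ^ (s : ℝ) := ENNReal.tsum_mul_left
    _ ≤ 10 ^ (s : ℝ) * packingPremeasureAt s δ F := by
        gcongr
        have hpack : IsBallPacking F δ ((fun a => (a, δ / (k + 1))) '' u k) := by
          refine ⟨(hcount k).image _, ?_, ?_⟩
          · rintro _ ⟨a, ha, rfl⟩
            refine ⟨huF k ha, hpos k, div_le_self hδ.le ?_⟩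
            simp
          · rintro _ ⟨a, ha, rfl⟩ _ ⟨b, hb, rfl⟩ hne
            exact hdisj k ha hb fun h => hne (by rw [h])
        refine le_trans (le_of_eq ?_) (le_iSup₂ (f := fun T (_ : IsBallPacking F δ T) =>
          ∑' p : T, Metric.ediam (Metric.closedBall p.1.1 p.1.2) ^ (s : ℝ)) _ hpack)
        rw [tsum_image (fun p : E × ℝ => Metric.ediam (Metric.closedBall p.1 p.2) ^ (s : ℝ))
          (fun a _ b _ hab => (Prod.ext_iff.1 hab).1)]

theorem dimH_le_packingDim (F : Set E) : dimH F ≤ packingDim F := by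
  borelize E
  refine le_iInf₂ fun s hs => dimH_le_of_hausdorffMeasure_ne_top ?_
  have h10 : (10 : ℝ≥0∞) ^ (s : ℝ) ≠ 0 := by
    simp [ENNReal.rpow_eq_zero_iff]
  have h10' : (10 : ℝ≥0∞) ^ (s : ℝ) ≠ ∞ := ENNReal.rpow_ne_top_of_nonneg s.coe_nonneg (by simp)
  have hle : ∀ G : Set E, (10 ^ (s : ℝ))⁻¹ * μH[s] G ≤ packingPremeasure s G := fun G =>
    le_iInf₂ fun δ hδ => by
      rw [mul_comm, ← div_eq_mul_inv]
      exact ENNReal.div_le_of_le_mul' (hausdorffMeasure_le_packingPremeasureAt s hδ G)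
  have hmain : (10 ^ (s : ℝ))⁻¹ * μH[s] F ≤ packingMeasure s F := by
    refine le_iInf₂ fun G hG => ?_
    calc (10 ^ (s : ℝ))⁻¹ * μH[s] F ≤ (10 ^ (s : ℝ))⁻¹ * ∑' i, μH[s] (G i) := by
          gcongr
          exact (measure_mono hG).trans (measure_iUnion_le _)
      _ = ∑' i, (10 ^ (s : ℝ))⁻¹ * μH[s] (G i) := ENNReal.tsum_mul_left.symm
      _ ≤ _ := ENNReal.tsum_le_tsum fun i => hle _
  rw [hs, nonpos_iff_eq_zero, mul_eq_zero, ENNReal.inv_eq_zero] at hmain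
  rcases hmain with h | h
  · exact absurd h h10'
  · simp [h]

end NormedSpaces

/-! ### Construction of the zigzag functions and their self-affinity -/

/-- The approximants of the zigzag functions: `zigzagApprox h s m n` vanishes to the left of `0`,
equals `h n` to the right of `1`, and traverses on the three thirds of `[0,1]` three copies of the
approximant of level `n + 1`, the middle one multiplied by `s n`. -/
noncomputable def zigzagApprox (h s : ℕ → ℝ) : ℕ → ℕ → ℝ → ℝ
  | 0, n, x => h n * max 0 (min 1 x)
  | m + 1, n, x => zigzagApprox h s m (n + 1) (3 * x) +
      s n * zigzagApprox h s m (n + 1) (3 * x - 1) + zigzagApprox h s m (n + 1) (3 * x - 2)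

/-- The zigzag function of level `n`, the limit of the approximants `zigzagApprox h s m n`. -/
noncomputable def zigzag (h s : ℕ → ℝ) (n : ℕ) (x : ℝ) : ℝ :=
  limUnder atTop fun m => zigzagApprox h s m n x

/-- Heights `h` and signs `s` for which the zigzag construction is consistent. -/
structure IsZigzagData (h s : ℕ → ℝ) : Prop where
  pos : ∀ n, 0 < h n
  sign : ∀ n, s n = 1 ∨ s n = -1
  step : ∀ n, h n = (2 + s n) * h (n + 1)
  tendsto : Tendsto h atTop (𝓝 0)

variable {h s : ℕ → ℝ}

theorem continuous_zigzagApprox (m n : ℕ) : Continuous (zigzagApprox h s m n) := by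
  induction m generalizing n with
  | zero =>
    rw [show zigzagApprox h s 0 n = fun x => h n * max 0 (min 1 x) from rfl]
    fun_prop
  | succ m ih =>
    have := ih (n + 1)
    rw [show zigzagApprox h s (m + 1) n = fun x => zigzagApprox h s m (n + 1) (3 * x) +
      s n * zigzagApprox h s m (n + 1) (3 * x - 1) + zigzagApprox h s m (n + 1) (3 * x - 2) from rfl]
    fun_prop

theorem zigzagApprox_of_nonpos (m n : ℕ) {x : ℝ} (hx : x ≤ 0) : zigzagApprox h s m n x = 0 := by
  induction m generalizing n x with
  | zero => simp [zigzagApprox, hx]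
  | succ m ih =>
    rw [zigzagApprox, ih _ (by linarith), ih _ (by linarith), ih _ (by linarith)]
    simp

namespace IsZigzagData

theorem zigzagApprox_of_one_le (H : IsZigzagData h s) (m n : ℕ) {x : ℝ} (hx : 1 ≤ x) :
    zigzagApprox h s m n x = h n := by
  induction m generalizing n x with
  | zero => simp [zigzagApprox, hx]
  | succ m ih =>
    rw [zigzagApprox, ih _ (by linarith), ih _ (by linarith), ih _ (by linarith), H.step n]
    ring

/-- On each third only one of the three copies varies; the others are constant, equal to `0` or `h
(n + 1)`. -/
theorem zigzagApprox_mem (H : IsZigzagData h s) (m n : ℕ) (x : ℝ) :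
    zigzagApprox h s m n x ∈ Icc 0 (h n) := by
  induction m generalizing n x with
  | zero =>
    have := H.pos n
    refine ⟨by rw [zigzagApprox]; positivity, ?_⟩
    rw [zigzagApprox]
    exact mul_le_of_le_one_right this.le (max_le zero_le_one (min_le_left _ _))
  | succ m ih =>
    have h1 := ih (n + 1) (3 * x)
    have h2 := ih (n + 1) (3 * x - 1)
    have h3 := ih (n + 1) (3 * x - 2)
    rw [zigzagApprox, H.step n]
    rcases le_total (3 * x) 1 with hx1 | hx1
    · rw [zigzagApprox_of_nonpos (x := 3 * x - 1) _ _ (by linarith),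
        zigzagApprox_of_nonpos (x := 3 * x - 2) _ _ (by linarith)]
      rcases H.sign n with hs | hs <;> rw [hs] <;> constructor <;> linarith [h1.1, h1.2]
    · rw [H.zigzagApprox_of_one_le (x := 3 * x) _ _ hx1]
      rcases le_total (3 * x) 2 with hx2 | hx2
      · rw [zigzagApprox_of_nonpos (x := 3 * x - 2) _ _ (by linarith)]
        rcases H.sign n with hs | hs <;> rw [hs] <;> constructor <;> linarith [h2.1, h2.2]
      · rw [H.zigzagApprox_of_one_le (x := 3 * x - 1) _ _ (by linarith)]
        rcases H.sign n with hs | hs <;> rw [hs] <;> constructor <;> linarith [h3.1, h3.2]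

/-- On each third the constant copies cancel in the difference, which is thus up to sign a
difference at level `n + 1`. After `m` reductions both values lie in `[0, h (n + m)]`. -/
theorem abs_zigzagApprox_sub_le (H : IsZigzagData h s) (m k l n : ℕ) (x : ℝ) :
    |zigzagApprox h s (m + k) n x - zigzagApprox h s (m + l) n x| ≤ h (n + m) := by
  induction m generalizing n x with
  | zero =>
    have h1 := H.zigzagApprox_mem (0 + k) n x
    have h2 := H.zigzagApprox_mem (0 + l) n x
    rw [abs_le, add_zero]
    constructor <;> linarith [h1.1, h1.2, h2.1, h2.2]
  | succ m ih =>
    have h1 := ih (n + 1) (3 * x)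
    have h2 := ih (n + 1) (3 * x - 1)
    have h3 := ih (n + 1) (3 * x - 2)
    rw [add_right_comm m 1 k, add_right_comm m 1 l, zigzagApprox, zigzagApprox,
      ← add_assoc, add_right_comm n m 1]
    rcases le_total (3 * x) 1 with hx1 | hx1
    · rw [zigzagApprox_of_nonpos (x := 3 * x - 1) _ _ (by linarith),
        zigzagApprox_of_nonpos (x := 3 * x - 2) _ _ (by linarith),
        zigzagApprox_of_nonpos (x := 3 * x - 1) _ _ (by linarith),
        zigzagApprox_of_nonpos (x := 3 * x - 2) _ _ (by linarith)]
      convert h1 using 2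
      ring
    · rw [H.zigzagApprox_of_one_le (x := 3 * x) _ _ hx1,
        H.zigzagApprox_of_one_le (x := 3 * x) _ _ hx1]
      rcases le_total (3 * x) 2 with hx2 | hx2
      · rw [zigzagApprox_of_nonpos (x := 3 * x - 2) _ _ (by linarith),
          zigzagApprox_of_nonpos (x := 3 * x - 2) _ _ (by linarith)]
        rcases H.sign n with hs | hs <;> rw [hs]
        · convert h2 using 2
          ring
        · rw [abs_sub_comm] at h2
          convert h2 using 2
          ring
      · rw [H.zigzagApprox_of_one_le (x := 3 * x - 1) _ _ (by linarith),
          H.zigzagApprox_of_one_le (x := 3 * x - 1) _ _ (by linarith)]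
        convert h3 using 2
        ring

theorem tendsto_zigzagApprox (H : IsZigzagData h s) (n : ℕ) (x : ℝ) :
    Tendsto (fun m => zigzagApprox h s m n x) atTop (𝓝 (zigzag h s n x)) := by
  refine CauchySeq.tendsto_limUnder
    (cauchySeq_of_le_tendsto_0 (fun m => h (n + m)) (fun a b m ha hb => ?_) ?_)
  · obtain ⟨k, rfl⟩ := Nat.exists_eq_add_of_le ha
    obtain ⟨l, rfl⟩ := Nat.exists_eq_add_of_le hb
    exact H.abs_zigzagApprox_sub_le m k l n x
  · exact (H.tendsto.comp (tendsto_add_atTop_nat n)).congr fun m => by simp [add_comm]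

theorem zigzag_mem (H : IsZigzagData h s) (n : ℕ) (x : ℝ) : zigzag h s n x ∈ Icc 0 (h n) :=
  isClosed_Icc.mem_of_tendsto (H.tendsto_zigzagApprox n x)
    (Eventually.of_forall fun m => H.zigzagApprox_mem m n x)

theorem zigzag_of_nonpos (H : IsZigzagData h s) (n : ℕ) {x : ℝ} (hx : x ≤ 0) :
    zigzag h s n x = 0 :=
  tendsto_nhds_unique (H.tendsto_zigzagApprox n x)
    (tendsto_const_nhds.congr fun m => (zigzagApprox_of_nonpos m n hx).symm)

theorem zigzag_of_one_le (H : IsZigzagData h s) (n : ℕ) {x : ℝ} (hx : 1 ≤ x) :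
    zigzag h s n x = h n :=
  tendsto_nhds_unique (H.tendsto_zigzagApprox n x)
    (tendsto_const_nhds.congr fun m => (H.zigzagApprox_of_one_le m n hx).symm)

theorem zigzag_eq (H : IsZigzagData h s) (n : ℕ) (x : ℝ) :
    zigzag h s n x = zigzag h s (n + 1) (3 * x) + s n * zigzag h s (n + 1) (3 * x - 1) +
      zigzag h s (n + 1) (3 * x - 2) :=
  tendsto_nhds_unique ((H.tendsto_zigzagApprox n x).comp (tendsto_add_atTop_nat 1))
    (((H.tendsto_zigzagApprox (n + 1) (3 * x)).add
      ((H.tendsto_zigzagApprox (n + 1) (3 * x - 1)).const_mul (s n))).add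
      (H.tendsto_zigzagApprox (n + 1) (3 * x - 2)))

theorem continuous_zigzag (H : IsZigzagData h s) (n : ℕ) : Continuous (zigzag h s n) := by
  refine TendstoUniformly.continuous (F := fun m => zigzagApprox h s m n) (p := atTop) ?_
    (Eventually.of_forall fun m => continuous_zigzagApprox m n).frequently
  rw [Metric.tendstoUniformly_iff]
  intro ε hε
  have hlim : Tendsto (fun m => h (n + m)) atTop (𝓝 0) :=
    (H.tendsto.comp (tendsto_add_atTop_nat n)).congr fun m => by simp [add_comm]
  filter_upwards [hlim.eventually_lt_const hε] with m hm x
  refine lt_of_le_of_lt ?_ hm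
  refine le_of_tendsto (((H.tendsto_zigzagApprox n x).comp (tendsto_add_atTop_nat m)).dist
    tendsto_const_nhds) (Eventually.of_forall fun k => ?_)
  rw [Real.dist_eq, Function.comp_apply, add_comm k m]
  exact H.abs_zigzagApprox_sub_le m k 0 n x

theorem zigzag_left (H : IsZigzagData h s) (n : ℕ) {u : ℝ} (h1 : u ≤ 1) :
    zigzag h s n (u / 3) = zigzag h s (n + 1) u := by
  rw [H.zigzag_eq, H.zigzag_of_nonpos (x := 3 * (u / 3) - 1) _ (by linarith),
    H.zigzag_of_nonpos (x := 3 * (u / 3) - 2) _ (by linarith), mul_div_cancel₀ u three_ne_zero]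
  ring

theorem zigzag_middle (H : IsZigzagData h s) (n : ℕ) {u : ℝ} (h0 : 0 ≤ u) (h1 : u ≤ 1) :
    zigzag h s n ((1 + u) / 3) = h (n + 1) + s n * zigzag h s (n + 1) u := by
  rw [H.zigzag_eq, H.zigzag_of_one_le (x := 3 * ((1 + u) / 3)) _ (by linarith),
    H.zigzag_of_nonpos (x := 3 * ((1 + u) / 3) - 2) _ (by linarith),
    mul_div_cancel₀ _ three_ne_zero, add_sub_cancel_left, add_zero]

theorem zigzag_right (H : IsZigzagData h s) (n : ℕ) {u : ℝ} (h0 : 0 ≤ u) :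
    zigzag h s n ((2 + u) / 3) = (1 + s n) * h (n + 1) + zigzag h s (n + 1) u := by
  rw [H.zigzag_eq, H.zigzag_of_one_le (x := 3 * ((2 + u) / 3)) _ (by linarith),
    H.zigzag_of_one_le (x := 3 * ((2 + u) / 3) - 1) _ (by linarith),
    mul_div_cancel₀ _ three_ne_zero, add_sub_cancel_left]
  ring

/-- On each triadic interval of length `3⁻ⁿ`, the zigzag function of level `0` is, up to sign and a
translation, a rescaled copy of the zigzag function of level `n`. -/
theorem exists_zigzag_eq (H : IsZigzagData h s) (n j : ℕ) (hj : j < 3 ^ n) :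
    ∃ c σ : ℝ, |σ| = 1 ∧ ∀ u ∈ Icc (0 : ℝ) 1,
      zigzag h s 0 ((j + u) / 3 ^ n) = c + σ * zigzag h s n u := by
  induction n generalizing j with
  | zero =>
    obtain rfl : j = 0 := by simpa using hj
    exact ⟨0, 1, by simp, fun u _ => by simp⟩
  | succ n ih =>
    obtain ⟨c, σ, hσ, hcu⟩ := ih (j / 3) (by omega)
    have hmod : j % 3 < 3 := Nat.mod_lt _ (by norm_num)
    have hdiv : (j : ℝ) = 3 * ((j / 3 : ℕ) : ℝ) + ((j % 3 : ℕ) : ℝ) := by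
      exact_mod_cast (Nat.div_add_mod j 3).symm
    have hr : (((j % 3 : ℕ) : ℝ)) ≤ 2 := by exact_mod_cast Nat.le_of_lt_succ hmod
    have hr0 : (0 : ℝ) ≤ ((j % 3 : ℕ) : ℝ) := Nat.cast_nonneg _
    have hkey : ∀ u ∈ Icc (0 : ℝ) 1, zigzag h s 0 ((j + u) / 3 ^ (n + 1)) =
        c + σ * zigzag h s n ((((j % 3 : ℕ) : ℝ) + u) / 3) := fun u hu => by
      rw [← hcu _ ⟨div_nonneg (by linarith [hu.1]) (by norm_num),
        by rw [div_le_one (by norm_num)]; linarith [hu.2]⟩, hdiv, pow_succ]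
      congr 1
      field_simp
      ring
    interval_cases hj3 : j % 3
    · refine ⟨c, σ, hσ, fun u hu => ?_⟩
      rw [hkey u hu, Nat.cast_zero, zero_add, H.zigzag_left n hu.2]
    · refine ⟨c + σ * h (n + 1), σ * s n, ?_, fun u hu => ?_⟩
      · rw [abs_mul, hσ]
        rcases H.sign n with hs | hs <;> rw [hs] <;> simp
      rw [hkey u hu, Nat.cast_one, H.zigzag_middle n hu.1 hu.2]
      ring
    · refine ⟨c + σ * ((1 + s n) * h (n + 1)), σ, hσ, fun u hu => ?_⟩
      rw [hkey u hu, Nat.cast_ofNat, H.zigzag_right n hu.1]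
      ring

end IsZigzagData

/-! ### Uniform distribution of the values and the lower bound for the Hausdorff dimension -/

theorem integral_eq_thirds {F : ℝ → ℝ} (hF : Continuous F) :
    ∫ u in (0 : ℝ)..1, F u = 3⁻¹ * ((∫ u in (0 : ℝ)..1, F (u / 3)) +
      (∫ u in (0 : ℝ)..1, F ((1 + u) / 3)) + ∫ u in (0 : ℝ)..1, F ((2 + u) / 3)) := by
  have h1 : ∫ u in (0 : ℝ)..1, F (u / 3) = 3 * ∫ u in (0 : ℝ)..(1 / 3), F u := by
    rw [intervalIntegral.integral_comp_div F three_ne_zero]; simp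
  have h2 : ∀ a : ℝ, ∫ u in (0 : ℝ)..1, F ((a + u) / 3) =
      3 * ∫ u in (a / 3)..((a + 1) / 3), F u := fun a => by
    rw [intervalIntegral.integral_comp_add_left (fun u => F (u / 3)),
      intervalIntegral.integral_comp_div F three_ne_zero]; simp
  have hi : ∀ a b : ℝ, IntervalIntegrable F volume a b := fun a b => hF.intervalIntegrable a b
  rw [h1, h2, h2, ← intervalIntegral.integral_add_adjacent_intervals (hi 0 (1 / 3)) (hi _ 1),
    ← intervalIntegral.integral_add_adjacent_intervals (hi (1 / 3) (2 / 3)) (hi _ 1)]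
  norm_num
  ring

namespace IsZigzagData

variable {h s : ℕ → ℝ}

/-- Both integrals split into averages of the same three integrals of level `n + 1`, so the error is
an average of errors one level deeper. The induction runs over all `φ` because the pieces compose
`φ` with translations and reflections. -/
theorem abs_integral_comp_zigzag_sub_le (H : IsZigzagData h s) {L : ℝ} (hL : 0 ≤ L) (m n : ℕ)
    {φ : ℝ → ℝ} (hφc : Continuous φ) (hφ : ∀ x y, |φ x - φ y| ≤ L * |x - y|) :
    |(∫ u in (0 : ℝ)..1, φ (zigzag h s n u)) - ∫ u in (0 : ℝ)..1, φ (h n * u)| ≤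
      L * h (n + m) := by
  have hcont : ∀ n {ψ : ℝ → ℝ}, Continuous ψ → Continuous fun u => ψ (zigzag h s n u) :=
    fun n ψ hψ => hψ.comp (H.continuous_zigzag n)
  induction m generalizing n φ with
  | zero =>
    have hlin : Continuous fun u => φ (h n * u) := by fun_prop
    rw [← intervalIntegral.integral_sub ((hcont n hφc).intervalIntegrable _ _)
      (hlin.intervalIntegrable _ _), ← Real.norm_eq_abs]
    refine (intervalIntegral.norm_integral_le_of_norm_le_const (C := L * h n)
      fun u hu => ?_).trans_eq (by simp)
    rw [uIoc_of_le zero_le_one] at hu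
    refine (hφ _ _).trans (mul_le_mul_of_nonneg_left ?_ hL)
    have h1 := H.zigzag_mem n u
    have hp := (H.pos n).le
    have h2 : 0 ≤ h n * u := mul_nonneg hp hu.1.le
    have h3 : h n * u ≤ h n := mul_le_of_le_one_right hp hu.2
    rw [abs_le]
    constructor <;> linarith [h1.1, h1.2]
  | succ m ih =>
    set φ₁ : ℝ → ℝ := fun x => φ (h (n + 1) + s n * x) with hφ₁
    set φ₂ : ℝ → ℝ := fun x => φ ((1 + s n) * h (n + 1) + x) with hφ₂
    have hc₁ : Continuous φ₁ := by fun_prop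
    have hc₂ : Continuous φ₂ := by fun_prop
    have hl₁ : ∀ x y, |φ₁ x - φ₁ y| ≤ L * |x - y| := fun x y => by
      refine (hφ _ _).trans_eq ?_
      have : |s n| = 1 := by rcases H.sign n with hs | hs <;> rw [hs] <;> simp
      rw [add_sub_add_left_eq_sub, ← mul_sub, abs_mul, this, one_mul]
    have hl₂ : ∀ x y, |φ₂ x - φ₂ y| ≤ L * |x - y| := fun x y => by
      refine (hφ _ _).trans_eq ?_
      rw [add_sub_add_left_eq_sub]
    have e0 := ih (n + 1) hφc hφ
    have e1 := ih (n + 1) hc₁ hl₁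
    have e2 := ih (n + 1) hc₂ hl₂
    have hz : ∫ u in (0 : ℝ)..1, φ (zigzag h s n u) = 3⁻¹ *
        ((∫ u in (0 : ℝ)..1, φ (zigzag h s (n + 1) u)) +
        (∫ u in (0 : ℝ)..1, φ₁ (zigzag h s (n + 1) u)) +
        ∫ u in (0 : ℝ)..1, φ₂ (zigzag h s (n + 1) u)) := by
      rw [integral_eq_thirds (hcont n hφc)]
      congr 1
      refine congrArg₂ _ (congrArg₂ _ ?_ ?_) ?_
      · refine intervalIntegral.integral_congr fun u hu => ?_
        rw [uIcc_of_le zero_le_one] at hu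
        simp only [H.zigzag_left n hu.2]
      · refine intervalIntegral.integral_congr fun u hu => ?_
        rw [uIcc_of_le zero_le_one] at hu
        simp only [H.zigzag_middle n hu.1 hu.2, hφ₁]
      · refine intervalIntegral.integral_congr fun u hu => ?_
        rw [uIcc_of_le zero_le_one] at hu
        simp only [H.zigzag_right n hu.1, hφ₂]
    have hlin : ∫ u in (0 : ℝ)..1, φ (h n * u) = 3⁻¹ *
        ((∫ u in (0 : ℝ)..1, φ (h (n + 1) * u)) + (∫ u in (0 : ℝ)..1, φ₁ (h (n + 1) * u)) +
        ∫ u in (0 : ℝ)..1, φ₂ (h (n + 1) * u)) := by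
      simp only [hφ₁, hφ₂, H.step n]
      rcases H.sign n with hs | hs
      · rw [integral_eq_thirds (by fun_prop), hs]
        congr 3 <;>
        · congr 1
          ext u
          congr 1
          ring
      -- For sign `-1` the heights `h n` and `h (n + 1)` agree, and `u ↦ 1 - u` turns the middle
      -- integral into the outer ones, so the average of the three is the integral over the whole
      -- segment.
      · have hrefl := intervalIntegral.integral_comp_sub_left (a := 0) (b := 1)
          (fun u => φ (h (n + 1) * u)) 1
        simp only [sub_self, sub_zero] at hrefl
        rw [hs]
        have h1 : (fun u => φ (h (n + 1) + -1 * (h (n + 1) * u))) =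
            fun u => φ (h (n + 1) * (1 - u)) := by
          ext u; congr 1; ring
        have h2 : (fun u => φ ((1 + -1) * h (n + 1) + h (n + 1) * u)) =
            fun u => φ (h (n + 1) * u) := by
          ext u; congr 1; ring
        have h3 : (fun u => φ ((2 + -1) * h (n + 1) * u)) = fun u => φ (h (n + 1) * u) := by
          ext u; congr 1; ring
        rw [h1, h2, h3, hrefl]
        ring
    rw [hz, hlin, ← mul_sub, abs_mul, abs_of_pos (by norm_num : (0 : ℝ) < 3⁻¹),
      ← add_assoc, add_right_comm n m 1]
    rw [abs_le] at e0 e1 e2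
    have : |(∫ u in (0 : ℝ)..1, φ (zigzag h s (n + 1) u)) +
        (∫ u in (0 : ℝ)..1, φ₁ (zigzag h s (n + 1) u)) +
        (∫ u in (0 : ℝ)..1, φ₂ (zigzag h s (n + 1) u)) -
        ((∫ u in (0 : ℝ)..1, φ (h (n + 1) * u)) + (∫ u in (0 : ℝ)..1, φ₁ (h (n + 1) * u)) +
        ∫ u in (0 : ℝ)..1, φ₂ (h (n + 1) * u))| ≤ 3 * (L * h (n + 1 + m)) := by
      rw [abs_le]
      constructor <;> linarith [e0.1, e0.2, e1.1, e1.2, e2.1, e2.2]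
    linarith

/-- The distribution of the values of a Lipschitz function along a zigzag function is the one along
the linear function with the same end values. -/
theorem integral_comp_zigzag (H : IsZigzagData h s) {L : ℝ} (hL : 0 ≤ L) (n : ℕ)
    {φ : ℝ → ℝ} (hφc : Continuous φ) (hφ : ∀ x y, |φ x - φ y| ≤ L * |x - y|) :
    ∫ u in (0 : ℝ)..1, φ (zigzag h s n u) = ∫ u in (0 : ℝ)..1, φ (h n * u) := by
  have hlim : Tendsto (fun m => L * h (n + m)) atTop (𝓝 0) := by
    rw [← mul_zero L]
    exact ((H.tendsto.comp (tendsto_add_atTop_nat n)).congr fun m => by simp [add_comm]).const_mul L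
  have := ge_of_tendsto hlim
    (Eventually.of_forall fun m => H.abs_integral_comp_zigzag_sub_le hL m n hφc hφ)
  exact sub_eq_zero.1 (abs_nonpos_iff.1 this)

/-- Markov's inequality is applied to a tent of height `2` that is at least `1` within `r` of `y`
and vanishes beyond `2 * r`. Its integral is at most `2 * (4 * r)`, whence the constant `8`. -/
theorem volume_zigzag_mem_le (H : IsZigzagData h s) (n : ℕ) (y : ℝ) {r : ℝ} (hr : 0 < r) :
    volume {u | u ∈ Icc (0 : ℝ) 1 ∧ |zigzag h s n u - y| ≤ r} ≤ ENNReal.ofReal (8 * r / h n) := by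
  have hh := H.pos n
  set φ : ℝ → ℝ := fun z => max 0 (2 - |z - y| / r) with hφdef
  have hφc : Continuous φ := by fun_prop
  have hφ0 : ∀ z, 0 ≤ φ z := fun z => le_max_left _ _
  have hφ : ∀ x z, |φ x - φ z| ≤ r⁻¹ * |x - z| := fun x z => by
    refine (abs_max_sub_max_le_max _ _ _ _).trans ?_
    rw [sub_self, abs_zero, max_eq_right (abs_nonneg _), sub_sub_sub_cancel_left, ← sub_div,
      abs_div, abs_of_pos hr, div_eq_inv_mul]
    refine mul_le_mul_of_nonneg_left ?_ (by positivity)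
    refine (abs_abs_sub_abs_le _ _).trans_eq ?_
    rw [abs_sub_comm x z]
    congr 1; ring
  have hint : ∫ u in (0 : ℝ)..1, φ (zigzag h s n u) ≤ 8 * r / h n := by
    rw [H.integral_comp_zigzag (by positivity) n hφc hφ,
      intervalIntegral.integral_comp_mul_left φ hh.ne', mul_zero, mul_one, smul_eq_mul,
      div_eq_inv_mul, intervalIntegral.integral_of_le hh.le]
    refine mul_le_mul_of_nonneg_left ?_ (by positivity)
    set J := Icc (y - 2 * r) (y + 2 * r) with hJ
    calc ∫ z in Ioc 0 (h n), φ z ≤ ∫ z in Ioc 0 (h n), J.indicator (fun _ => (2 : ℝ)) z := by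
          refine setIntegral_mono (hφc.integrableOn_Ioc)
            ((integrable_const (2 : ℝ)).indicator measurableSet_Icc) fun z => ?_
          by_cases hz : z ∈ J
          · rw [indicator_of_mem hz]
            exact max_le zero_le_two (by linarith [div_nonneg (abs_nonneg (z - y)) hr.le])
          · rw [indicator_of_notMem hz]
            refine max_le le_rfl ?_
            rw [sub_nonpos, le_div_iff₀ hr]
            by_contra! hlt
            obtain ⟨h1, h2⟩ := abs_lt.1 hlt
            exact hz ⟨by linarith, by linarith⟩
      _ = 2 * (volume.restrict (Ioc 0 (h n))).real J := by
          rw [integral_indicator_const _ measurableSet_Icc, smul_eq_mul, mul_comm]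
      _ ≤ 2 * volume.real J := by
          gcongr
          exact ENNReal.toReal_mono isCompact_Icc.measure_lt_top.ne (Measure.restrict_apply_le _ _)
      _ = 8 * r := by
          rw [hJ, Real.volume_real_Icc_of_le (by linarith)]; ring
  have hcont : Continuous fun u => φ (zigzag h s n u) := hφc.comp (H.continuous_zigzag n)
  have hmarkov := mul_meas_ge_le_integral_of_nonneg (μ := volume.restrict (Ioc (0 : ℝ) 1))
    (f := fun u => φ (zigzag h s n u)) (Eventually.of_forall fun u => hφ0 _)
    hcont.integrableOn_Ioc 1
  rw [one_mul, ← intervalIntegral.integral_of_le zero_le_one] at hmarkov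
  have hms : MeasurableSet {u | 1 ≤ φ (zigzag h s n u)} :=
    (isClosed_le continuous_const hcont).measurableSet
  calc volume {u | u ∈ Icc (0 : ℝ) 1 ∧ |zigzag h s n u - y| ≤ r}
      ≤ (volume.restrict (Icc (0 : ℝ) 1)) {u | 1 ≤ φ (zigzag h s n u)} := by
        rw [Measure.restrict_apply hms]
        refine measure_mono fun u hu => ⟨le_max_of_le_right (?_ : (1 : ℝ) ≤ _), hu.1⟩
        have : |zigzag h s n u - y| / r ≤ 1 := (div_le_one hr).2 hu.2
        linarith
    _ = (volume.restrict (Ioc (0 : ℝ) 1)) {u | 1 ≤ φ (zigzag h s n u)} := by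
        rw [restrict_Ioc_eq_restrict_Icc]
    _ = ENNReal.ofReal ((volume.restrict (Ioc (0 : ℝ) 1)).real {u | 1 ≤ φ (zigzag h s n u)}) := by
        rw [ofReal_measureReal]
    _ ≤ _ := ENNReal.ofReal_le_ofReal (hmarkov.trans hint)

theorem volume_zigzag_floor_le (H : IsZigzagData h s) (n : ℕ) (k : ℤ) (b : ℝ) {r : ℝ}
    (hr : 0 < r) :
    volume {x | x ∈ Ico (0 : ℝ) 1 ∧ ⌊3 ^ n * x⌋ = k ∧ |zigzag h s 0 x - b| ≤ r} ≤
      ENNReal.ofReal (8 * r / (3 ^ n * h n)) := by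
  have h3 : (0 : ℝ) < 3 ^ n := by positivity
  by_cases hk : 0 ≤ k ∧ k < 3 ^ n
  swap
  · refine le_of_eq_of_le ?_ zero_le
    convert measure_empty (μ := (volume : Measure ℝ))
    refine eq_empty_iff_forall_notMem.2 fun x ⟨hx, hxk, _⟩ => hk ?_
    rw [← hxk]
    refine ⟨Int.floor_nonneg.2 (mul_nonneg h3.le hx.1), Int.floor_lt.2 ?_⟩
    push_cast
    exact mul_lt_of_lt_one_right h3 hx.2
  obtain ⟨hk0, hk3⟩ := hk
  lift k to ℕ using hk0
  obtain ⟨c, σ, hσ, hcu⟩ := H.exists_zigzag_eq n k (by exact_mod_cast hk3)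
  set S := {u | u ∈ Icc (0 : ℝ) 1 ∧ |zigzag h s n u - σ * (b - c)| ≤ r} with hS
  have hsub : {x | x ∈ Ico (0 : ℝ) 1 ∧ ⌊3 ^ n * x⌋ = (k : ℤ) ∧ |zigzag h s 0 x - b| ≤ r} ⊆
      (fun x => (3 : ℝ) ^ n * x) ⁻¹' ((fun x => x + -(k : ℝ)) ⁻¹' S) := by
    rintro x ⟨hx, hxk, hxb⟩
    rw [Int.floor_eq_iff, Int.cast_natCast] at hxk
    have hmem : 3 ^ n * x + -(k : ℝ) ∈ Icc (0 : ℝ) 1 :=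
      ⟨by linarith [hxk.1], by linarith [hxk.2]⟩
    refine ⟨hmem, ?_⟩
    have := hcu _ hmem
    rw [show (k : ℝ) + (3 ^ n * x + -(k : ℝ)) = 3 ^ n * x by ring, mul_div_cancel_left₀ _ h3.ne'] at this
    rw [this] at hxb
    refine le_of_eq_of_le ?_ hxb
    rcases eq_or_eq_neg_of_abs_eq hσ with h1 | h1
    · rw [h1]; congr 1; ring
    · rw [h1, ← abs_neg]; congr 1; ring
  refine (measure_mono hsub).trans ?_
  rw [Real.volume_preimage_mul_left h3.ne', measure_preimage_add_right]
  refine (mul_le_mul_right (H.volume_zigzag_mem_le n _ hr) _).trans_eq ?_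
  rw [← ENNReal.ofReal_mul (abs_nonneg _), abs_of_pos (inv_pos.2 h3)]
  congr 1
  have := H.pos n
  field_simp

/-- An interval of radius at most `3⁻ⁿ` meets at most three triadic intervals of length `3⁻ⁿ`; hence
`24 = 3 * 8`. -/
theorem volume_zigzag_box_le (H : IsZigzagData h s) (n : ℕ) (a b : ℝ) {r : ℝ} (hr : 0 < r)
    (hrn : r ≤ (3 ^ n)⁻¹) :
    volume {x | x ∈ Ico (0 : ℝ) 1 ∧ |x - a| ≤ r ∧ |zigzag h s 0 x - b| ≤ r} ≤
      ENNReal.ofReal (24 * r / (3 ^ n * h n)) := by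
  have h3 : (0 : ℝ) < 3 ^ n := by positivity
  have hh := H.pos n
  calc volume {x | x ∈ Ico (0 : ℝ) 1 ∧ |x - a| ≤ r ∧ |zigzag h s 0 x - b| ≤ r}
      ≤ volume (⋃ k ∈ Finset.Icc (⌊3 ^ n * a⌋ - 1) (⌊3 ^ n * a⌋ + 1),
        {x | x ∈ Ico (0 : ℝ) 1 ∧ ⌊3 ^ n * x⌋ = k ∧ |zigzag h s 0 x - b| ≤ r}) := by
        refine measure_mono fun x ⟨hx, hxa, hxb⟩ => ?_
        refine mem_iUnion₂.2 ⟨⌊3 ^ n * x⌋, ?_, hx, rfl, hxb⟩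
        have hd : |3 ^ n * x - 3 ^ n * a| ≤ 1 := by
          rw [← mul_sub, abs_mul, abs_of_pos h3]
          calc 3 ^ n * |x - a| ≤ 3 ^ n * (3 ^ n)⁻¹ := by gcongr; exact hxa.trans hrn
            _ = 1 := mul_inv_cancel₀ h3.ne'
        rw [abs_le] at hd
        rw [Finset.mem_Icc]
        constructor
        · rw [Int.le_floor]
          push_cast
          linarith [Int.floor_le (3 ^ n * a), hd.1]
        · rw [← Int.lt_add_one_iff, Int.floor_lt]
          push_cast
          linarith [Int.lt_floor_add_one (3 ^ n * a), hd.2]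
    _ ≤ ∑ k ∈ Finset.Icc (⌊3 ^ n * a⌋ - 1) (⌊3 ^ n * a⌋ + 1),
        ENNReal.ofReal (8 * r / (3 ^ n * h n)) :=
        (measure_biUnion_finset_le _ _).trans
          (Finset.sum_le_sum fun k _ => H.volume_zigzag_floor_le n k b hr)
    _ = ENNReal.ofReal (24 * r / (3 ^ n * h n)) := by
        rw [Finset.sum_const, Int.card_Icc, nsmul_eq_mul,
          show (⌊3 ^ n * a⌋ + 1 + 1 - (⌊3 ^ n * a⌋ - 1)).toNat = 3 by omega, ← ENNReal.ofReal_natCast,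
          ← ENNReal.ofReal_mul (by positivity)]
        congr 1
        push_cast
        ring

/-- The zigzag function of level `0` on the unit interval. -/
noncomputable def toContinuousMap (H : IsZigzagData h s) : C(unitInterval, ℝ) :=
  ⟨fun x => zigzag h s 0 x, (H.continuous_zigzag 0).comp continuous_subtype_val⟩

/-- Lower bound on the Hausdorff dimension of the graph of a zigzag function by the mass
distribution principle. -/
theorem le_dimH_graph (H : IsZigzagData h s) {d : ℝ≥0}
    (hd : ∀ᶠ n : ℕ in atTop, 24 * (3 ^ n)⁻¹ / (3 ^ n * h n) ≤ (((3 : ℝ) ^ (n + 1))⁻¹) ^ (d : ℝ)) :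
    d ≤ dimH (graph H.toContinuousMap) := by
  set G : ℝ → EuclideanSpace ℝ (Fin 2) := fun x => !₂[x, zigzag h s 0 x] with hG
  have hGc : Continuous G := by
    have := H.continuous_zigzag 0
    refine (PiLp.continuous_toLp 2 _).comp (continuous_pi fun i => ?_)
    fin_cases i
    · exact continuous_id
    · exact this
  set ν : Measure (EuclideanSpace ℝ (Fin 2)) := (volume.restrict (Ico (0 : ℝ) 1)).map G with hν
  have hbox : ∀ (q : EuclideanSpace ℝ (Fin 2)) (r : ℝ), ν (Metric.closedBall q r) ≤
      volume {x | x ∈ Ico (0 : ℝ) 1 ∧ |x - q 0| ≤ r ∧ |zigzag h s 0 x - q 1| ≤ r} := by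
    intro q r
    rw [hν, Measure.map_apply hGc.measurable Metric.isClosed_closedBall.measurableSet,
      Measure.restrict_apply (hGc.measurable Metric.isClosed_closedBall.measurableSet)]
    refine measure_mono fun x ⟨hx, hx1⟩ => ⟨hx1, ?_, ?_⟩
    · exact (PiLp.norm_apply_le (G x - q) 0).trans (mem_closedBall_iff_norm.1 hx)
    · exact (PiLp.norm_apply_le (G x - q) 1).trans (mem_closedBall_iff_norm.1 hx)
  obtain ⟨N, hN⟩ := eventually_atTop.1 hd
  have hle : ν ≤ μH[d] := by
    refine Measure.le_hausdorffMeasure _ _ (ENNReal.ofReal (3 ^ N)⁻¹)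
      (ENNReal.ofReal_pos.2 (by positivity)) fun U hU => ?_
    rcases U.eq_empty_or_nonempty with rfl | ⟨q, hq⟩
    · simp
    have htop : Metric.ediam U ≠ ∞ := ne_top_of_le_ne_top ENNReal.ofReal_ne_top hU
    set r := (Metric.ediam U).toReal with hr
    have hUr : Metric.ediam U = ENNReal.ofReal r := (ENNReal.ofReal_toReal htop).symm
    have hr0 : 0 ≤ r := ENNReal.toReal_nonneg
    have hUq : U ⊆ Metric.closedBall q r := fun p hp => by
      rw [Metric.mem_closedBall, ← edist_le_ofReal hr0, ← hUr]
      exact Metric.edist_le_ediam_of_mem hp hq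
    refine (measure_mono hUq).trans ((hbox q r).trans ?_)
    rcases hr0.eq_or_lt with h0 | hpos
    · refine le_of_eq_of_le (measure_mono_null (t := {q 0}) (fun x hx => ?_) (by simp)) zero_le
      have := hx.2.1
      rw [← h0] at this
      exact sub_eq_zero.1 (abs_nonpos_iff.1 this)
    rw [hUr, ENNReal.ofReal_le_ofReal_iff (by positivity)] at hU
    have hx1 : r * 3 ^ N ≤ 1 := by
      rwa [← le_div_iff₀ (by positivity), one_div]
    -- The level is chosen as `n = N + k` with `3 ^ (-(n + 1)) < r ≤ 3 ^ (-n)`.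
    obtain ⟨k, hk1, hk2⟩ := exists_nat_pow_near_of_lt_one (x := r * 3 ^ N)
      (y := 3⁻¹) (by positivity) hx1 (by norm_num) (by norm_num)
    have e1 : ((3 : ℝ) ^ (N + k + 1))⁻¹ < r := by
      rw [inv_pow] at hk1
      rw [add_assoc, pow_add, mul_inv, inv_mul_lt_iff₀ (by positivity), mul_comm]
      exact hk1
    have e2 : r ≤ ((3 : ℝ) ^ (N + k))⁻¹ := by
      rw [inv_pow] at hk2
      rw [pow_add, mul_inv, le_inv_mul_iff₀ (by positivity), mul_comm]
      exact hk2
    refine (H.volume_zigzag_box_le (N + k) (q 0) (q 1) hpos e2).trans ?_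
    rw [hUr, ENNReal.ofReal_rpow_of_pos hpos]
    refine ENNReal.ofReal_le_ofReal ?_
    have hh := H.pos (N + k)
    calc 24 * r / (3 ^ (N + k) * h (N + k))
        ≤ 24 * (3 ^ (N + k))⁻¹ / (3 ^ (N + k) * h (N + k)) := by gcongr
      _ ≤ (((3 : ℝ) ^ (N + k + 1))⁻¹) ^ (d : ℝ) := hN _ (Nat.le_add_right _ _)
      _ ≤ r ^ (d : ℝ) := by gcongr
  refine le_dimH_of_hausdorffMeasure_ne_zero fun h0 => ?_
  have h1 : ν (graph H.toContinuousMap) = 0 := nonpos_iff_eq_zero.1 (h0 ▸ hle _)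
  have h2 := Measure.le_map_apply (μ := volume.restrict (Ico (0 : ℝ) 1)) hGc.aemeasurable
    (graph H.toContinuousMap)
  rw [← hν, h1, nonpos_iff_eq_zero] at h2
  have h3 : Ico (0 : ℝ) 1 ⊆ G ⁻¹' graph H.toContinuousMap := fun x hx =>
    ⟨⟨x, hx.1, hx.2.le⟩, rfl⟩
  have h4 := measure_mono_null h3 h2
  simp at h4

end IsZigzagData

/-! ### Upper bound for the box dimension, and Lipschitz perturbations -/

theorem coverNumber_anti {X : Type*} [MetricSpace X] (F : Set X) {δ ε : ℝ} (h : δ ≤ ε) :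
    coverNumber F ε ≤ coverNumber F δ :=
  le_iInf₂ fun _ ⟨U, hU, hF⟩ =>
    coverNumber_le U (fun i => (hU i).trans (ENNReal.ofReal_le_ofReal h)) hF

theorem coverNumber_le_card {X ι : Type*} [MetricSpace X] [Fintype ι] {F : Set X} {δ : ℝ}
    (U : ι → Set X) (hU : ∀ i, Metric.ediam (U i) ≤ ENNReal.ofReal δ) (hF : F ⊆ ⋃ i, U i) :
    coverNumber F δ ≤ Fintype.card ι := by
  refine coverNumber_le (fun k => U ((Fintype.equivFin ι).symm k)) (fun k => hU _) (hF.trans ?_)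
  rw [(Fintype.equivFin ι).symm.surjective.iUnion_comp U]

theorem dist_le_add_abs (p q : EuclideanSpace ℝ (Fin 2)) :
    dist p q ≤ |p 0 - q 0| + |p 1 - q 1| := by
  rw [EuclideanSpace.dist_eq, Fin.sum_univ_two, Real.dist_eq, Real.dist_eq]
  refine Real.sqrt_le_iff.2 ⟨by positivity, ?_⟩
  nlinarith [abs_nonneg (p 0 - q 0), abs_nonneg (p 1 - q 1)]

theorem abs_apply_sub_le_dist (p q : EuclideanSpace ℝ (Fin 2)) (i : Fin 2) :
    |p i - q i| ≤ dist p q := by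
  rw [dist_eq_norm]
  exact PiLp.norm_apply_le (p - q) i

/-- A graph whose oscillation on each triadic interval of length `3⁻ⁿ` is at most `N 3⁻ⁿ` is
covered by `(3ⁿ + 1) (2 N + 1)` sets of diameter at most `2 · 3⁻ⁿ`. -/
theorem coverNumber_graph_le (f : C(unitInterval, ℝ)) (n N : ℕ)
    (hf : ∀ x y : unitInterval, ⌊(3 : ℝ) ^ n * x⌋ = ⌊(3 : ℝ) ^ n * y⌋ →
      3 ^ n * |f x - f y| ≤ N) :
    coverNumber (graph f) (2 * (3 ^ n)⁻¹) ≤ ((3 ^ n + 1) * (2 * N + 1) : ℕ) := by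
  have h3 : (0 : ℝ) < 3 ^ n := by positivity
  -- The additional index `j = 3 ^ n` serves the end point `x = 1`.
  have hx0 : ∀ j : Fin (3 ^ n + 1), ((j : ℕ) : ℝ) / 3 ^ n ∈ unitInterval := fun j =>
    ⟨by positivity, (div_le_one h3).2 (by exact_mod_cast Nat.le_of_lt_succ j.2)⟩
  set x₀ : Fin (3 ^ n + 1) → unitInterval := fun j => ⟨_, hx0 j⟩ with hx₀
  set U : Fin (3 ^ n + 1) × Finset.Icc (-N : ℤ) N → Set (EuclideanSpace ℝ (Fin 2)) := fun i =>
    (fun x : unitInterval => !₂[(x : ℝ), f x]) ''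
      {x | ⌊(3 : ℝ) ^ n * x⌋ = (i.1 : ℕ) ∧ ⌊3 ^ n * (f x - f (x₀ i.1))⌋ = (i.2 : ℤ)} with hU
  refine (coverNumber_le_card U ?_ ?_).trans_eq ?_
  · rintro ⟨j, i⟩
    refine Metric.ediam_le ?_
    rintro _ ⟨x, ⟨hx1, hx2⟩, rfl⟩ _ ⟨y, ⟨hy1, hy2⟩, rfl⟩
    rw [edist_le_ofReal (by positivity)]
    refine (dist_le_add_abs _ _).trans ?_
    have e1 := (Int.abs_sub_lt_one_of_floor_eq_floor (hx1.trans hy1.symm)).le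
    have e2 := (Int.abs_sub_lt_one_of_floor_eq_floor (hx2.trans hy2.symm)).le
    rw [← mul_sub, abs_mul, abs_of_pos h3, mul_comm, ← le_div_iff₀ h3, one_div] at e1
    rw [← mul_sub, abs_mul, abs_of_pos h3, mul_comm, ← le_div_iff₀ h3, one_div,
      sub_sub_sub_cancel_right] at e2
    rw [two_mul]
    exact add_le_add e1 e2
  · rintro _ ⟨x, rfl⟩
    have hfl0 : 0 ≤ ⌊(3 : ℝ) ^ n * x⌋ := Int.floor_nonneg.2 (mul_nonneg h3.le x.2.1)
    obtain ⟨j, hj⟩ := Int.eq_ofNat_of_zero_le hfl0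
    have hj3 : j < 3 ^ n + 1 := by
      have : ((j : ℤ) : ℝ) ≤ 3 ^ n := by
        rw [← hj]
        exact (Int.floor_le _).trans (mul_le_of_le_one_right h3.le x.2.2)
      exact Nat.lt_succ_of_le (by exact_mod_cast this)
    have hfx := hf x (x₀ ⟨j, hj3⟩) (by
      rw [hj]
      simp only [hx₀]
      rw [mul_div_cancel₀ _ h3.ne', Int.floor_natCast])
    nth_rw 1 [← abs_of_pos h3] at hfx
    rw [← abs_mul, abs_le] at hfx
    refine mem_iUnion.2 ⟨⟨⟨j, hj3⟩, ⟨⌊3 ^ n * (f x - f (x₀ ⟨j, hj3⟩))⌋, ?_⟩⟩, x, ⟨hj, rfl⟩, rfl⟩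
    rw [Finset.mem_Icc]
    constructor
    · rw [Int.le_floor]
      push_cast
      exact hfx.1
    · exact_mod_cast (Int.floor_le _).trans hfx.2
  · rw [Fintype.card_prod, Fintype.card_fin, Fintype.card_coe, Int.card_Icc]
    congr 2
    omega

/-- Upper bound on the box dimension of a graph from the oscillation of the function on triadic
intervals. -/
theorem upperBoxDim_graph_le (f : C(unitInterval, ℝ)) {h : ℕ → ℝ} {A B β : ℝ} (hA : 0 ≤ A)
    (hB : 0 ≤ B) (hβ : 0 ≤ β) (hh : ∀ n, ((3 : ℝ) ^ n)⁻¹ ≤ h n)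
    (hhβ : ∀ n, 3 ^ n * (3 ^ n * h n) ≤ B * ((3 : ℝ) ^ n) ^ β)
    (hf : ∀ n, ∀ x y : unitInterval, ⌊(3 : ℝ) ^ n * x⌋ = ⌊(3 : ℝ) ^ n * y⌋ →
      |f x - f y| ≤ A * h n) :
    upperBoxDim (graph f) ≤ β := by
  -- With `n = k + 1` and `δ / 2 ≤ 3 ^ (-k)` one has `3 ^ n ≤ 6 / δ`, which gives `6 ^ β`. The other
  -- factors come from `3 ^ n + 1 ≤ 2 * 3 ^ n` and, as `3 ^ n * h n ≥ 1`, from `2 * N + 1 ≤ (2 * A +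
  -- 3) * (3 ^ n * h n)`.
  refine upperBoxDim_le_of_coverNumber_le (C := 2 * (2 * A + 3) * B * 6 ^ β) ?_
  filter_upwards [Ioo_mem_nhdsGT one_pos] with δ hδ
  obtain ⟨k, hk1, hk2⟩ := exists_nat_pow_near_of_lt_one (x := δ / 2) (y := (3 : ℝ)⁻¹)
    (by linarith [hδ.1]) (by linarith [hδ.2]) (by norm_num) (by norm_num)
  set n := k + 1 with hn
  have h3 : (1 : ℝ) ≤ 3 ^ n := one_le_pow₀ (by norm_num)
  have h3h : 1 ≤ 3 ^ n * h n := by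
    have := hh n
    rwa [inv_le_iff_one_le_mul₀' (by positivity)] at this
  set N := ⌈3 ^ n * (A * h n)⌉₊ with hN
  have hNle : (N : ℝ) ≤ A * (3 ^ n * h n) + 1 := by
    have h0 : 0 ≤ 3 ^ n * (A * h n) := by
      rw [mul_left_comm]; exact mul_nonneg hA (zero_le_one.trans h3h)
    rw [mul_left_comm A]
    exact (Nat.ceil_lt_add_one h0).le
  have hcov := coverNumber_graph_le f n N fun x y hxy =>
    (mul_le_mul_of_nonneg_left (hf n x y hxy) (by positivity)).trans (Nat.le_ceil _)
  have hδn : 2 * ((3 : ℝ) ^ n)⁻¹ ≤ δ := by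
    rw [← inv_pow]; linarith
  have hcard : (coverNumber (graph f) δ : ℝ≥0∞) ≤ (((3 ^ n + 1) * (2 * N + 1) : ℕ) : ℝ≥0∞) := by
    exact_mod_cast ENat.toENNReal_le.2 ((coverNumber_anti _ hδn).trans hcov)
  refine hcard.trans ?_
  rw [← ENNReal.ofReal_natCast]
  refine ENNReal.ofReal_le_ofReal ?_
  have hpow : ((3 : ℝ) ^ n) ^ β ≤ 6 ^ β * δ ^ (-β) := by
    rw [Real.rpow_neg hδ.1.le, ← Real.inv_rpow hδ.1.le, ← Real.mul_rpow (by norm_num)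
      (inv_nonneg.2 hδ.1.le)]
    refine Real.rpow_le_rpow (by positivity) ?_ hβ
    rw [inv_pow, le_inv_comm₀ (by linarith [hδ.1]) (by positivity)] at hk2
    rw [hn, pow_succ]
    have : (δ / 2)⁻¹ = 2 * δ⁻¹ := by rw [inv_div, div_eq_mul_inv]
    linarith
  push_cast
  calc ((3 : ℝ) ^ n + 1) * (2 * N + 1)
      ≤ (2 * 3 ^ n) * (2 * (A * (3 ^ n * h n) + 1) + 3 ^ n * h n) := by
        gcongr
        linarith
    _ ≤ (2 * 3 ^ n) * ((2 * A + 3) * (3 ^ n * h n)) := by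
        gcongr
        linarith
    _ = 2 * (2 * A + 3) * (3 ^ n * (3 ^ n * h n)) := by ring
    _ ≤ 2 * (2 * A + 3) * (B * (6 ^ β * δ ^ (-β))) := by
        exact mul_le_mul_of_nonneg_left ((hhβ n).trans (mul_le_mul_of_nonneg_left hpow hB))
          (by positivity)
    _ = 2 * (2 * A + 3) * B * 6 ^ β * δ ^ (-β) := by ring

theorem IsZigzagData.abs_zigzag_sub_le {h s : ℕ → ℝ} (H : IsZigzagData h s) (n : ℕ)
    {x y : unitInterval} (hxy : ⌊(3 : ℝ) ^ n * x⌋ = ⌊(3 : ℝ) ^ n * y⌋) :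
    |zigzag h s 0 x - zigzag h s 0 y| ≤ h n := by
  have h3 : (0 : ℝ) < 3 ^ n := by positivity
  obtain ⟨j, hj⟩ := Int.eq_ofNat_of_zero_le
    (Int.floor_nonneg.2 (mul_nonneg h3.le x.2.1) : 0 ≤ ⌊(3 : ℝ) ^ n * x⌋)
  have hjy := hxy.symm.trans hj
  rw [Int.floor_eq_iff] at hj hjy
  simp only [Int.cast_natCast] at hj hjy
  rcases lt_or_ge j (3 ^ n) with hj3 | hj3
  · obtain ⟨c, σ, hσ, hcu⟩ := H.exists_zigzag_eq n j hj3
    have key : ∀ z : ℝ, (j : ℝ) ≤ 3 ^ n * z → 3 ^ n * z < j + 1 →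
        zigzag h s 0 z = c + σ * zigzag h s n (3 ^ n * z - j) := fun z h1 h2 => by
      rw [← hcu _ ⟨by linarith, by linarith⟩, add_sub_cancel, mul_div_cancel_left₀ _ h3.ne']
    rw [key x hj.1 hj.2, key y hjy.1 hjy.2, add_sub_add_left_eq_sub, ← mul_sub, abs_mul, hσ,
      one_mul, abs_le]
    have m1 := H.zigzag_mem n (3 ^ n * x - j)
    have m2 := H.zigzag_mem n (3 ^ n * y - j)
    constructor <;> linarith [m1.1, m1.2, m2.1, m2.2]
  · have hj3' : (3 : ℝ) ^ n ≤ j := by exact_mod_cast hj3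
    have hx : (1 : ℝ) ≤ x := le_of_mul_le_mul_left (by linarith [hj.1]) h3
    have hy : (1 : ℝ) ≤ y := le_of_mul_le_mul_left (by linarith [hjy.1]) h3
    rw [H.zigzag_of_one_le 0 hx, H.zigzag_of_one_le 0 hy, sub_self, abs_zero]
    exact (H.pos n).le

/-- Adding a Lipschitz function to a nonzero multiple of `g` does not decrease the Hausdorff
dimension of the graph. -/
theorem dimH_graph_le_of_lipschitz {f g : C(unitInterval, ℝ)} {p : ℝ → ℝ} {L : ℝ≥0}
    (hp : LipschitzOnWith L p (Icc 0 1)) {c : ℝ} (hc : c ≠ 0) (hf : ∀ x, f x = p x + c * g x) :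
    dimH (graph g) ≤ dimH (graph f) := by
  -- The inverse of the shear that carries the graph of `g` to that of `f`; it is Lipschitz over
  -- `[0,1]`.
  set Φ : EuclideanSpace ℝ (Fin 2) → EuclideanSpace ℝ (Fin 2) := fun q =>
    !₂[q 0, c⁻¹ * (q 1 - p (q 0))] with hΦ
  have himage : graph g ⊆ Φ '' graph f := by
    rintro _ ⟨x, rfl⟩
    refine ⟨_, ⟨x, rfl⟩, ?_⟩
    simp [hΦ, hf x, hc]
  have hlip : LipschitzOnWith (1 + ‖c⁻¹‖₊ * (1 + L)) Φ (graph f) := by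
    refine LipschitzOnWith.of_dist_le_mul ?_
    rintro q ⟨x, hx⟩ q' ⟨y, hy⟩
    have hq : q 0 ∈ Icc (0 : ℝ) 1 := by rw [← hx]; exact x.2
    have hq' : q' 0 ∈ Icc (0 : ℝ) 1 := by rw [← hy]; exact y.2
    have d0 := abs_apply_sub_le_dist q q' 0
    have d1 := abs_apply_sub_le_dist q q' 1
    have hpd := hp.dist_le_mul _ hq _ hq'
    rw [Real.dist_eq, Real.dist_eq] at hpd
    refine (dist_le_add_abs _ _).trans ?_
    have e0 : Φ q 0 - Φ q' 0 = q 0 - q' 0 := rfl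
    have e1 : Φ q 1 - Φ q' 1 = c⁻¹ * ((q 1 - q' 1) - (p (q 0) - p (q' 0))) := by
      simp only [hΦ, PiLp.toLp_apply, Matrix.cons_val_one, Matrix.cons_val_zero]
      ring
    rw [e0, e1, abs_mul]
    push_cast
    rw [Real.norm_eq_abs, add_mul, one_mul, mul_assoc]
    refine add_le_add d0 (mul_le_mul_of_nonneg_left ?_ (abs_nonneg _))
    calc |(q 1 - q' 1) - (p (q 0) - p (q' 0))|
        ≤ |q 1 - q' 1| + |p (q 0) - p (q' 0)| := abs_sub _ _
      _ ≤ dist q q' + L * dist q q' :=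
          add_le_add d1 (hpd.trans (mul_le_mul_of_nonneg_left d0 L.coe_nonneg))
      _ = (1 + L) * dist q q' := by ring
  exact (dimH_mono himage).trans hlip.dimH_image_le

/-! ### Choice of the heights and density -/

/-- A nondecreasing integer sequence with steps at most one, tending to infinity, which is
asymptotic to `α n`. -/
theorem exists_nat_seq {α : ℝ} (h0 : 0 ≤ α) (h1 : α ≤ 1) :
    ∃ K : ℕ → ℕ, (∀ n, K (n + 1) = K n ∨ K (n + 1) = K n + 1) ∧ Tendsto K atTop atTop ∧
      (∀ n, K n ≤ n) ∧ (∀ n, α * n ≤ K n + 1) ∧ ∀ n : ℕ, (K n : ℝ) ≤ α * n + √n := by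
  -- The term with `√n` forces `K` to infinity even for `α = 0`. Its factor `1 - α` keeps `k n ≤ n`
  -- and the increments at most `1`.
  set k : ℕ → ℝ := fun n => α * n + (1 - α) * √n with hk
  have hα : 0 ≤ 1 - α := sub_nonneg.2 h1
  have hk0 : ∀ n, 0 ≤ k n := fun n => by positivity
  have hsqrt : ∀ n : ℕ, √(n : ℝ) ≤ n := fun n => by
    rcases Nat.eq_zero_or_pos n with rfl | hn
    · simp
    · rw [Real.sqrt_le_left (Nat.cast_nonneg _)]
      have : (1 : ℝ) ≤ n := by exact_mod_cast hn
      nlinarith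
  have hstep : ∀ n : ℕ, √((n + 1 : ℕ) : ℝ) ≤ √n + 1 := fun n => by
    rw [Real.sqrt_le_left (by positivity)]
    push_cast
    nlinarith [Real.sq_sqrt (Nat.cast_nonneg (α := ℝ) n), Real.sqrt_nonneg (n : ℝ)]
  have hmono : ∀ n : ℕ, √(n : ℝ) ≤ √((n + 1 : ℕ) : ℝ) := fun n =>
    Real.sqrt_le_sqrt (by push_cast; linarith)
  refine ⟨fun n => ⌊k n⌋₊, fun n => ?_, ?_, fun n => ?_, fun n => ?_, fun n => ?_⟩
  · have hle : ⌊k n⌋₊ ≤ ⌊k (n + 1)⌋₊ := by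
      refine Nat.floor_le_floor ?_
      have := mul_le_mul_of_nonneg_left (hmono n) hα
      simp only [hk]
      push_cast at this ⊢
      linarith
    have hle' : ⌊k (n + 1)⌋₊ ≤ ⌊k n⌋₊ + 1 := by
      rw [← Nat.floor_add_one (hk0 n)]
      refine Nat.floor_le_floor ?_
      have := mul_le_mul_of_nonneg_left (hstep n) hα
      simp only [hk]
      push_cast at this ⊢
      linarith
    dsimp only
    omega
  · refine tendsto_nat_floor_atTop.comp (tendsto_atTop_mono (f := fun n : ℕ => √(n : ℝ))
      (fun n => ?_) (Real.tendsto_sqrt_atTop.comp tendsto_natCast_atTop_atTop))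
    have := mul_le_mul_of_nonneg_left (hsqrt n) h0
    simp only [hk]
    linarith
  · refine Nat.floor_le_of_le ?_
    have := mul_le_mul_of_nonneg_left (hsqrt n) hα
    simp only [hk]
    linarith
  · have := (Nat.lt_floor_add_one (k n)).le
    have h2 : 0 ≤ (1 - α) * √n := by positivity
    simp only [hk] at this ⊢
    linarith
  · refine (Nat.floor_le (hk0 n)).trans ?_
    have : (1 - α) * √n ≤ 1 * √n := by gcongr; linarith
    simp only [hk]
    linarith

/-- With `h n = 3 ^ (-K n)`, a level has sign `1` exactly when `K` increases there. Taking `K n`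
close to `(2 - β) * n` makes `3 ^ n * (3 ^ n * h n)` comparable to `3 ^ (β * n)` up to a
subexponential factor. -/
theorem exists_isZigzagData {β : ℝ} (hβ₁ : 1 ≤ β) (hβ₂ : β ≤ 2) :
    ∃ h s : ℕ → ℝ, IsZigzagData h s ∧ (∀ n, ((3 : ℝ) ^ n)⁻¹ ≤ h n) ∧ (∀ n, h n ≤ 1) ∧
      (∀ n, 3 ^ n * (3 ^ n * h n) ≤ 3 * ((3 : ℝ) ^ n) ^ β) ∧
      ∀ d : ℝ, d < β → ∀ᶠ n : ℕ in atTop,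
        24 * (3 ^ n)⁻¹ / (3 ^ n * h n) ≤ (((3 : ℝ) ^ (n + 1))⁻¹) ^ d := by
  obtain ⟨K, hstep, hK, hKn, hKl, hKu⟩ :=
    exists_nat_seq (α := 2 - β) (by linarith) (by linarith)
  refine ⟨fun n => ((3 : ℝ) ^ K n)⁻¹, fun n => if K (n + 1) = K n then -1 else 1,
    ⟨fun n => by positivity, fun n => ?_, fun n => ?_, ?_⟩, fun n => ?_, fun n => ?_, fun n => ?_,
    fun d hd => ?_⟩
  · split_ifs <;> simp
  · rcases hstep n with h | h
    · rw [if_pos h, h]; norm_num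
    · rw [if_neg (by omega), h, pow_succ]; field_simp; norm_num
  · exact tendsto_inv_atTop_zero.comp
      ((tendsto_pow_atTop_atTop_of_one_lt (by norm_num)).comp hK)
  · have := hKn n
    exact inv_anti₀ (by positivity) (pow_le_pow_right₀ (by norm_num) this)
  · exact inv_le_one_of_one_le₀ (one_le_pow₀ (by norm_num))
  · have h3 : (0 : ℝ) < 3 := by norm_num
    have e : (3 : ℝ) ^ n * (3 ^ n * (3 ^ K n)⁻¹) = 3 ^ ((n : ℝ) + n - K n) := by
      rw [Real.rpow_sub h3, Real.rpow_add h3]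
      simp only [Real.rpow_natCast]
      ring
    have e' : 3 * ((3 : ℝ) ^ n) ^ β = 3 ^ (1 + n * β) := by
      rw [Real.rpow_add h3, Real.rpow_one, Real.rpow_mul h3.le, Real.rpow_natCast]
    rw [e, e']
    refine Real.rpow_le_rpow_of_exponent_le (by norm_num) ?_
    have := hKl n
    linarith
  · have h3 : (0 : ℝ) < 3 := by norm_num
    -- Bounding `24` by `3 ^ 3`, the claim reduces to `√n + d + 3 ≤ (β - d) * n`, which holds once
    -- `√n` exceeds this threshold.
    have hev : ∀ᶠ n : ℕ in atTop, max 1 ((|d| + 4) / (β - d)) ≤ √(n : ℝ) :=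
      (Real.tendsto_sqrt_atTop.comp tendsto_natCast_atTop_atTop).eventually_ge_atTop _
    filter_upwards [hev] with n hn
    have ht1 : 1 ≤ √(n : ℝ) := (le_max_left _ _).trans hn
    have ht2 : |d| + 4 ≤ √(n : ℝ) * (β - d) :=
      (div_le_iff₀ (sub_pos.2 hd)).1 ((le_max_right _ _).trans hn)
    have hsq : √(n : ℝ) * √n = n := Real.mul_self_sqrt (Nat.cast_nonneg n)
    have hmain : √(n : ℝ) + d + 3 ≤ (β - d) * n := by
      have := mul_le_mul_of_nonneg_left ht2 (zero_le_one.trans ht1)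
      rw [← mul_assoc, hsq] at this
      nlinarith [abs_nonneg d, le_abs_self d]
    have e : 24 * ((3 : ℝ) ^ n)⁻¹ / (3 ^ n * (3 ^ K n)⁻¹) = 24 * 3 ^ ((K n : ℝ) - (n + n)) := by
      rw [Real.rpow_sub h3, Real.rpow_add h3]
      simp only [Real.rpow_natCast]
      field_simp
    have e' : (((3 : ℝ) ^ (n + 1))⁻¹) ^ d = 3 ^ (-((n + 1) * d)) := by
      rw [Real.inv_rpow (by positivity), ← Real.rpow_natCast, ← Real.rpow_mul h3.le,
        Real.rpow_neg h3.le]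
      push_cast
      rfl
    rw [e, e']
    calc 24 * (3 : ℝ) ^ ((K n : ℝ) - (n + n)) ≤ 3 ^ (3 : ℝ) * 3 ^ ((K n : ℝ) - (n + n)) := by
          gcongr
          norm_num
      _ = 3 ^ (3 + ((K n : ℝ) - (n + n))) := (Real.rpow_add h3 _ _).symm
      _ ≤ 3 ^ (-((n + 1) * d)) := by
          refine Real.rpow_le_rpow_of_exponent_le (by norm_num) ?_
          have := hKu n
          linarith

/-- The continuous functions whose graph has Hausdorff dimension at least `β` and upper box
dimension at most `β` are dense. -/
theorem dense_le_dimH_and_upperBoxDim_le {β : ℝ} (hβ₁ : 1 ≤ β) (hβ₂ : β ≤ 2) :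
    Dense {f : C(unitInterval, ℝ) |
      ENNReal.ofReal β ≤ dimH (graph f) ∧ upperBoxDim (graph f) ≤ β} := by
  obtain ⟨h, s, H, hh, hh1, hhβ, hd⟩ := exists_isZigzagData hβ₁ hβ₂
  have hdim : ENNReal.ofReal β ≤ dimH (graph H.toContinuousMap) := by
    refine le_of_forall_lt_imp_le_of_dense fun a ha => ?_
    lift a to ℝ≥0 using ha.ne_top
    refine H.le_dimH_graph (hd a ?_)
    rwa [← ENNReal.ofReal_coe_nnreal, ENNReal.ofReal_lt_ofReal_iff (by linarith)] at ha
  refine Metric.dense_iff.2 fun f₀ ε hε => ?_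
  obtain ⟨p, hp⟩ := exists_polynomial_near_continuousMap 0 1 f₀ (ε / 2) (by positivity)
  -- Since `z` has norm at most `1`, the total error is below `ε / 2 + ε / 3 < ε`.
  set c : ℝ := ε / 3 with hc
  have hc0 : 0 < c := by positivity
  obtain ⟨L, hL⟩ := LocallyLipschitzOn.exists_lipschitzOnWith_of_compact
    (isCompact_Icc (a := (0 : ℝ)) (b := 1))
    (LocallyLipschitz.locallyLipschitzOn (f := fun x => p.eval x) (s := Icc 0 1)
      (ContDiff.locallyLipschitz (𝕂 := ℝ) (by simpa using p.contDiff_aeval (𝕜 := ℝ) 1)))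
  set f : C(unitInterval, ℝ) := p.toContinuousMapOn (Icc 0 1) + c • H.toContinuousMap with hf
  have hfx : ∀ x : unitInterval, f x = p.eval (x : ℝ) + c * H.toContinuousMap x := fun x => rfl
  refine ⟨f, ?_, ?_, ?_⟩
  · have hz : ‖c • H.toContinuousMap‖ ≤ c := by
      rw [ContinuousMap.norm_le _ hc0.le]
      intro x
      have hm := H.zigzag_mem 0 x
      rw [ContinuousMap.smul_apply, norm_smul, Real.norm_of_nonneg hc0.le]
      refine mul_le_of_le_one_right hc0.le ?_
      rw [Real.norm_of_nonneg (show 0 ≤ H.toContinuousMap x from hm.1)]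
      exact hm.2.trans (hh1 0)
    rw [mem_ball_iff_norm, hf, add_sub_right_comm]
    refine (norm_add_le _ _).trans_lt ?_
    linarith
  · exact hdim.trans (dimH_graph_le_of_lipschitz hL hc0.ne' hfx)
  · refine upperBoxDim_graph_le f (A := L + c) (B := 3) (by positivity) (by norm_num)
      (by linarith) hh hhβ fun n x y hxy => ?_
    have h3 : (0 : ℝ) < 3 ^ n := by positivity
    have hxy1 := (Int.abs_sub_lt_one_of_floor_eq_floor hxy).le
    rw [← mul_sub, abs_mul, abs_of_pos h3, mul_comm, ← le_div_iff₀ h3, one_div] at hxy1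
    have hpd := hL.dist_le_mul _ x.2 _ y.2
    rw [Real.dist_eq, Real.dist_eq] at hpd
    have hzd := H.abs_zigzag_sub_le n hxy
    rw [hfx, hfx]
    calc |p.eval (x : ℝ) + c * H.toContinuousMap x - (p.eval (y : ℝ) + c * H.toContinuousMap y)|
        = |(p.eval (x : ℝ) - p.eval (y : ℝ)) + c * (zigzag h s 0 x - zigzag h s 0 y)| := by
          congr 1
          change _ + c * zigzag h s 0 x - (_ + c * zigzag h s 0 y) = _
          ring
      _ ≤ |p.eval (x : ℝ) - p.eval (y : ℝ)| + c * |zigzag h s 0 x - zigzag h s 0 y| := by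
          refine (abs_add_le _ _).trans_eq ?_
          rw [abs_mul, abs_of_pos hc0]
      _ ≤ L * h n + c * h n := by
          refine add_le_add (hpd.trans ?_) (by gcongr)
          exact mul_le_mul_of_nonneg_left (hxy1.trans (hh n)) L.coe_nonneg
      _ = (L + c) * h n := by ring

/-! ### The limiting inequalities between the dimensions -/

section Sandwich

variable {X : Type*} [MetricSpace X] {F : Set X} {β : ℝ}

theorem packingDim_le_of_upperBoxDim_le (hβ : 0 ≤ β) (h : upperBoxDim F ≤ β) :
    packingDim F ≤ ENNReal.ofReal β := by
  refine ENNReal.le_of_forall_pos_le_add fun ε hε _ => ?_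
  have : packingDim F ≤ ((β.toNNReal + ε : ℝ≥0) : ℝ≥0∞) := by
    refine packingDim_le_of_upperBoxDim_lt (h.trans_lt ?_)
    rw [NNReal.coe_add, Real.coe_toNNReal β hβ]
    exact_mod_cast lt_add_of_pos_right β (NNReal.coe_pos.2 hε)
  exact_mod_cast this

theorem le_lowerBoxDim_of_le_dimH (hβ : 0 < β) (h : ENNReal.ofReal β ≤ dimH F) :
    β ≤ lowerBoxDim F := by
  by_contra! hlt
  obtain ⟨r, hr, hrβ⟩ := EReal.lt_iff_exists_real_btwn.1 hlt
  -- The real `r` may be negative, so it is truncated at `0`; positivity of `β` excludes that case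
  -- at the end.
  have hr' : lowerBoxDim F < ((r.toNNReal : ℝ≥0) : ℝ) := by
    refine hr.trans_le ?_
    exact_mod_cast Real.le_coe_toNNReal r
  have := h.trans (dimH_le_of_lowerBoxDim_lt hr')
  rw [← ENNReal.ofReal, ENNReal.ofReal_le_ofReal_iff' ] at this
  rcases this with h1 | h1
  · exact absurd (by exact_mod_cast hrβ) h1.not_gt
  · exact absurd hβ h1.not_gt

end Sandwich

end FractalDim

theorem theorem3p2 (β : ℝ) (hβ₁ : 1 ≤ β) (hβ₂ : β ≤ 2) :
    Dense {f : C(unitInterval, ℝ) | dimH (FractalDim.graph f) = ENNReal.ofReal β} ∧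
    Dense {f : C(unitInterval, ℝ) | FractalDim.HasBoxDim (FractalDim.graph f) β} ∧
    Dense {f : C(unitInterval, ℝ) |
      FractalDim.packingDim (FractalDim.graph f) = ENNReal.ofReal β} := by
  have hD := FractalDim.dense_le_dimH_and_upperBoxDim_le hβ₁ hβ₂
  have hβ : 0 < β := by linarith
  refine ⟨hD.mono fun f hf => ?_, hD.mono fun f hf => ?_, hD.mono fun f hf => ?_⟩
  · exact le_antisymm
      ((FractalDim.dimH_le_packingDim _).trans (FractalDim.packingDim_le_of_upperBoxDim_le hβ.le hf.2)) hf.1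
  · have hlow := FractalDim.le_lowerBoxDim_of_le_dimH hβ hf.1
    have hle : FractalDim.lowerBoxDim (FractalDim.graph f) ≤
        FractalDim.upperBoxDim (FractalDim.graph f) := Filter.liminf_le_limsup
    exact ⟨le_antisymm (hle.trans hf.2) hlow, le_antisymm hf.2 (hlow.trans hle)⟩
  · exact le_antisymm (FractalDim.packingDim_le_of_upperBoxDim_le hβ.le hf.2)
      (hf.1.trans (FractalDim.dimH_le_packingDim _))
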